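/- Consider a vacuum pp-wave in Brinkmann coordinates, i.e. the metric $$g=-2\,du\,dv-2H\,du^2+2\,d\zeta\,d\bar\zeta,\qquad H=\mathrm{Re}\,f(\zeta,u),$$ on an open set $U\subset\mathbb R^4$ with coordinates $(u,v,x,y)$, $\zeta=x+iy$, where $f$ is smooth and holomorphic in $\zeta$. A null tetrad on $U$ consists of smooth vector fields $\ell,n$ (real) and $m$ (complex) whose only nonvanishing scalar products are $g(\ell,n)=-1$ and $g(m,\bar m)=1$. It is canonical if the Weyl tensor $C$ has $\Psi_0=\Psi_1=\Psi_2=\Psi_3=0$ and $\Psi_4=C(n,\bar m,n,\bar m)=1$. Put $$\alpha_c=\tfrac12\big(g(\nabla_{\bar m}n,\ell)-g(\nabla_{\bar m}\bar m,m)\big),\qquad \gamma_c=\tfrac12\big(g(\nabla_{n}n,\ell)-g(\nabla_{n}\bar m,m)\big).$$ Suppose that $(U,g)$ is a plane wave, i.e. there is a canonical tetrad on $U$ with $\alpha_c=0$, and that its invariant $\gamma_c$ is real-valued on $U$. Then every point of $U$ has a neighbourhood in $U$ with smooth coordinates $(u,r,x,y)$ (renamed), $u$ taking values in an open interval $I\subset(0,\infty)$,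 in which $g$ has the Rosen form $$g=-e^{2Y}du\,dr+u^2\big[\cosh 2Z\,(dx^2+dy^2)+\sinh 2Z\cos 2W\,(dx^2-dy^2)-2\sinh 2Z\sin 2W\,dx\,dy\big]$$ with smooth functions $Y,Z,W:I\to\mathbb R$ of $u$ satisfying the vacuum equation $2Y'=u\,(Z'^2+W'^2\sinh^2 2Z)$, and with $W'=0$ on $I$. -/

import Mathlib

open scoped ContDiff

noncomputable section

namespace PlaneWave

/-! ### Pseudo-Riemannian geometry in a coordinate domain of `ℝ⁴` -/

/-- Coordinate space `ℝ⁴`. -/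
abbrev Pt : Type := Fin 4 → ℝ

/-- A field of symmetric bilinear forms, given by its coordinate components `g_{ab}`. -/
abbrev MetricField : Type := Pt → Matrix (Fin 4) (Fin 4) ℝ

/-- The coordinate partial derivative `∂_a F` at `p`. -/
def pd {E : Type} [NormedAddCommGroup E] [NormedSpace ℝ E] (a : Fin 4) (F : Pt → E) (p : Pt) : E :=
  fderiv ℝ F p (Pi.single a 1)

/-- Christoffel symbols `Γ^a_{bc}` of the Levi-Civita connection. -/
def christoffel (g : MetricField) (p : Pt) (a b c : Fin 4) : ℝ :=
  (1 / 2) * ∑ d, (g p)⁻¹ a d *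
    (pd b (fun q => g q d c) p + pd c (fun q => g q d b) p - pd d (fun q => g q b c) p)

/-- The Riemann tensor
`R^a_{bcd} = ∂_c Γ^a_{bd} - ∂_d Γ^a_{bc} + Γ^a_{ec} Γ^e_{bd} - Γ^a_{ed} Γ^e_{bc}`. -/
def riemann (g : MetricField) (p : Pt) (a b c d : Fin 4) : ℝ :=
  pd c (fun q => christoffel g q a b d) p - pd d (fun q => christoffel g q a b c) p
    + ∑ e, (christoffel g p a e c * christoffel g p e b d
        - christoffel g p a e d * christoffel g p e b c)

/-- The Riemann tensor with all indices lowered, `R_{abcd}`. -/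
def riemannLow (g : MetricField) (p : Pt) (a b c d : Fin 4) : ℝ :=
  ∑ e, g p a e * riemann g p e b c d

/-- The Ricci tensor `R_{bd} = R^a_{bad}`. -/
def ricci (g : MetricField) (p : Pt) (b d : Fin 4) : ℝ :=
  ∑ a, riemann g p a b a d

/-- The scalar curvature. -/
def scalarCurv (g : MetricField) (p : Pt) : ℝ :=
  ∑ b, ∑ d, (g p)⁻¹ b d * ricci g p b d

/-- The Weyl tensor `C_{abcd}` in dimension four. -/
def weyl (g : MetricField) (p : Pt) (a b c d : Fin 4) : ℝ :=
  riemannLow g p a b c d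
    - (1 / 2) * (g p a c * ricci g p b d - g p a d * ricci g p b c
        + g p b d * ricci g p a c - g p b c * ricci g p a d)
    + (scalarCurv g p / 6) * (g p a c * g p b d - g p a d * g p b c)

/-! ### Complex vectors -/

/-- Complexified tangent vectors. -/
abbrev CVec : Type := Fin 4 → ℂ

/-- Complex conjugation of tangent vectors. -/
def cconj (X : CVec) : CVec := fun a => (starRingEnd ℂ) (X a)

/-- The metric, extended complex bilinearly. -/
def inn (g : MetricField) (p : Pt) (X Y : CVec) : ℂ :=
  ∑ a, ∑ b, (g p a b : ℂ) * X a * Y b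

/-- The Weyl tensor, extended complex multilinearly. -/
def weylC (g : MetricField) (p : Pt) (X Y V W : CVec) : ℂ :=
  ∑ a, ∑ b, ∑ c, ∑ d, (weyl g p a b c d : ℂ) * X a * Y b * V c * W d

/-- The covariant derivative `∇_V X` at `p` of a complex vector field `X` along a complex
tangent vector `V`. -/
def covD (g : MetricField) (p : Pt) (V : CVec) (X : Pt → CVec) : CVec :=
  fun a => ∑ b, V b * (pd b (fun q => X q a) p + ∑ c, (christoffel g p a b c : ℂ) * X p c)

/-! ### Null tetrads, Weyl scalars, spin coefficients -/

/-- A quadruple of vector fields `(ℓ, n, m, m̄)` with `ℓ`, `n` real and `m` complex. -/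
structure Tetrad where
  l : Pt → Fin 4 → ℝ
  n : Pt → Fin 4 → ℝ
  m : Pt → CVec

namespace Tetrad

variable (e : Tetrad)

/-- `ℓ` as a complex vector field. -/
def lC (p : Pt) : CVec := fun a => (e.l p a : ℂ)

/-- `n` as a complex vector field. -/
def nC (p : Pt) : CVec := fun a => (e.n p a : ℂ)

/-- The conjugate field `m̄`. -/
def mBar (p : Pt) : CVec := cconj (e.m p)

/-- `e` is a smooth null tetrad for `g` on `U`: the only nonvanishing scalar products are
`g(ℓ, n) = -1` and `g(m, m̄) = 1`. -/
structure IsNullTetrad (g : MetricField) (U : Set Pt) : Prop where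
  smooth_l : ContDiffOn ℝ ∞ e.l U
  smooth_n : ContDiffOn ℝ ∞ e.n U
  smooth_m : ContDiffOn ℝ ∞ e.m U
  l_l : ∀ p ∈ U, inn g p (e.lC p) (e.lC p) = 0
  n_n : ∀ p ∈ U, inn g p (e.nC p) (e.nC p) = 0
  m_m : ∀ p ∈ U, inn g p (e.m p) (e.m p) = 0
  l_m : ∀ p ∈ U, inn g p (e.lC p) (e.m p) = 0
  n_m : ∀ p ∈ U, inn g p (e.nC p) (e.m p) = 0
  l_n : ∀ p ∈ U, inn g p (e.lC p) (e.nC p) = -1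
  m_mBar : ∀ p ∈ U, inn g p (e.m p) (e.mBar p) = 1

/-- Weyl scalar `Ψ₀ = C(ℓ, m, ℓ, m)`. -/
def psi0 (g : MetricField) (p : Pt) : ℂ := weylC g p (e.lC p) (e.m p) (e.lC p) (e.m p)

/-- Weyl scalar `Ψ₁ = C(ℓ, n, ℓ, m)`. -/
def psi1 (g : MetricField) (p : Pt) : ℂ := weylC g p (e.lC p) (e.nC p) (e.lC p) (e.m p)

/-- Weyl scalar `Ψ₂ = C(ℓ, m, m̄, n)`. -/
def psi2 (g : MetricField) (p : Pt) : ℂ := weylC g p (e.lC p) (e.m p) (e.mBar p) (e.nC p)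

/-- Weyl scalar `Ψ₃ = C(ℓ, n, m̄, n)`. -/
def psi3 (g : MetricField) (p : Pt) : ℂ := weylC g p (e.lC p) (e.nC p) (e.mBar p) (e.nC p)

/-- Weyl scalar `Ψ₄ = C(n, m̄, n, m̄)`. -/
def psi4 (g : MetricField) (p : Pt) : ℂ := weylC g p (e.nC p) (e.mBar p) (e.nC p) (e.mBar p)

/-- Spin coefficient `α = ½ (g(∇_{m̄} n, ℓ) - g(∇_{m̄} m̄, m))`. -/
def spinAlpha (g : MetricField) (p : Pt) : ℂ :=
  (1 / 2) * (inn g p (covD g p (e.mBar p) e.nC) (e.lC p)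
    - inn g p (covD g p (e.mBar p) e.mBar) (e.m p))

/-- Spin coefficient `γ = ½ (g(∇_n n, ℓ) - g(∇_n m̄, m))`. -/
def spinGamma (g : MetricField) (p : Pt) : ℂ :=
  (1 / 2) * (inn g p (covD g p (e.nC p) e.nC) (e.lC p)
    - inn g p (covD g p (e.nC p) e.mBar) (e.m p))

/-- A canonical tetrad of a Petrov type N metric: the Weyl tensor has `Ψ₄` as its only
nonvanishing component, normalized to `Ψ₄ = 1`. -/
structure IsCanonical (g : MetricField) (U : Set Pt) : Prop extends e.IsNullTetrad g U where
  psi0_eq : ∀ p ∈ U, e.psi0 g p = 0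
  psi1_eq : ∀ p ∈ U, e.psi1 g p = 0
  psi2_eq : ∀ p ∈ U, e.psi2 g p = 0
  psi3_eq : ∀ p ∈ U, e.psi3 g p = 0
  psi4_eq : ∀ p ∈ U, e.psi4 g p = 1

end Tetrad

/-! ### Vacuum pp-waves in Brinkmann coordinates -/

/-- The complex transverse coordinate `ζ = x + i y` of a point with coordinates `(u, v, x, y)`. -/
def zeta (p : Pt) : ℂ := ⟨p 2, p 3⟩

/-- The Brinkmann metric `-2 du dv - 2 H du² + 2 dζ dζ̄` with `H = Re f(ζ, u)`, in the real
coordinates `(u, v, x, y)`, `ζ = x + i y`. -/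
def brinkmann (f : ℂ → ℝ → ℂ) : MetricField := fun p =>
  !![-2 * (f (zeta p) (p 0)).re, -1, 0, 0;
     -1, 0, 0, 0;
     0, 0, 2, 0;
     0, 0, 0, 2]

/-- `f(ζ, u)` is an admissible profile on `U`: smooth, and holomorphic in `ζ`
(which makes the Brinkmann metric a vacuum metric). -/
structure IsProfile (f : ℂ → ℝ → ℂ) (U : Set Pt) : Prop where
  smooth : ContDiffOn ℝ ∞ (fun p : Pt => f (zeta p) (p 0)) U
  holo : ∀ p ∈ U, DifferentiableAt ℂ (fun z => f z (p 0)) (zeta p)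

/-- A vacuum plane wave on `U` with canonical tetrad `e`: a vacuum pp-wave whose spin
coefficient `α` vanishes relative to the canonical tetrad. -/
structure IsVacuumPlaneWave (f : ℂ → ℝ → ℂ) (U : Set Pt) (e : Tetrad) : Prop where
  isOpen : IsOpen U
  profile : IsProfile f U
  canonical : e.IsCanonical (brinkmann f) U
  alpha_eq : ∀ p ∈ U, e.spinAlpha (brinkmann f) p = 0

/-! ### The Rosen form -/

/-- The Bondi-Pirani-Robinson parametrization of the Rosen metric in coordinates `(u, r, x, y)`:
`-e^{2Y} du dr + u² [cosh 2Z (dx² + dy²) + sinh 2Z cos 2W (dx² - dy²) - 2 sinh 2Z sin 2W dx dy]`. -/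
def rosenBPR (Y Z W : ℝ → ℝ) : MetricField := fun p =>
  let u := p 0
  !![0, -Real.exp (2 * Y u) / 2, 0, 0;
     -Real.exp (2 * Y u) / 2, 0, 0, 0;
     0, 0, u ^ 2 * (Real.cosh (2 * Z u) + Real.sinh (2 * Z u) * Real.cos (2 * W u)),
       -(u ^ 2 * (Real.sinh (2 * Z u) * Real.sin (2 * W u)));
     0, 0, -(u ^ 2 * (Real.sinh (2 * Z u) * Real.sin (2 * W u))),
       u ^ 2 * (Real.cosh (2 * Z u) - Real.sinh (2 * Z u) * Real.cos (2 * W u))]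

/-- The pullback of `h` along a change of coordinates `φ`. -/
def pullback (φ : Pt → Pt) (h : MetricField) : MetricField := fun q => Matrix.of fun a b =>
  ∑ c, ∑ d, h (φ q) c d * pd a (fun x => φ x c) q * pd b (fun x => φ x d) q

/-- `φ` is a smooth coordinate system, defined on `φ.source`, in which `g` has the
Bondi-Pirani-Robinson Rosen form with functions `Y, Z, W` that are smooth on the positive open
interval `(a, b)` in which the coordinate `u` takes its values and that satisfy there the vacuum
equation `2 Y' = u (Z'² + W'² sinh² 2Z)`. -/
structure IsRosenChart (g : MetricField) (φ : OpenPartialHomeomorph Pt Pt) (a b : ℝ)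
    (Y Z W : ℝ → ℝ) : Prop where
  smooth : ContDiffOn ℝ ∞ φ φ.source
  smooth_symm : ContDiffOn ℝ ∞ φ.symm φ.target
  pos : 0 < a
  mem : ∀ q ∈ φ.source, φ q 0 ∈ Set.Ioo a b
  smooth_Y : ContDiffOn ℝ ∞ Y (Set.Ioo a b)
  smooth_Z : ContDiffOn ℝ ∞ Z (Set.Ioo a b)
  smooth_W : ContDiffOn ℝ ∞ W (Set.Ioo a b)
  vacuum : ∀ u ∈ Set.Ioo a b,
    2 * deriv Y u = u * (deriv Z u ^ 2 + deriv W u ^ 2 * Real.sinh (2 * Z u) ^ 2)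
  metric_eq : ∀ q ∈ φ.source, g q = pullback φ (rosenBPR Y Z W) q

end PlaneWave

end

open scoped ContDiff

noncomputable section

namespace PlaneWave

/-! ### Calculus of coordinate partial derivatives -/

section PartialDerivatives

variable {E : Type} [NormedAddCommGroup E] [NormedSpace ℝ E] {F G : Pt → E} {U : Set Pt} {p : Pt}

/-! In Brinkmann coordinates the Weyl tensor is built from the transverse Hessian of the profile
`H`, which is trace-free because `H` is the real part of a holomorphic function. The conditions `Ψ₀
= 0` and `Ψ₄ = 1` force `ℓ` to be a multiple of `∂_v`, and force `m` to have no `u` component and an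
isotropic transverse part `m^y = ε m^x`, with `ε = ±i` locally constant (`l_zero`,
`tetrad_components`, `exists_orientation`).

Then `Ψ₄ = 1` reads `2 A² B² Φ = 1`, where `A = n^u`, `B` is the conjugate of `m^x` and `Φ = H_xx -
ε H_xy`. The spin coefficients are combinations of `dA/A` and `dB/B`, so a logarithmic derivative
gives `4αΦ = m̄(Φ)` and `4γΦ = n(Φ)` (`spin_eq_log_derivative`). Together with harmonicity, `α = 0`
makes `Φ` a function of `u` alone, so `H` is quadratic in `x, y`. Real `γ` makes the argument of `Φ`
constant, so one fixed rotation diagonalizes the Hessian for every `u`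
(`profile_eq_linearly_polarized`).

In the rotated coordinates `H = h₀ + b₁X + b₂Y + ρ(X² - Y²)/2`. A solution of the transverse
geodesic equations serves as moving origin, and solutions of the homogeneous equations `P'' =
-ρP/2`, `Q'' = ρQ/2` serve as scale factors. Dividing the displacements from the origin by `P` and
`Q`, and shifting `v` by a quadratic expression in these displacements, turns the metric into `-2 du
dV + 2P² dX² + 2Q² dY²`. The Rosen coordinate is the area radius `R = √(2PQ)`, with `e^{2Z} = P/Q`,
`e^{2Y} = 2/R'` and `W = 0`. Since `P''Q + PQ'' = 0`, differentiating `R²` twice gives the vacuum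
equation (`exists_rosen_functions`, `exists_rosenChart`). -/

theorem differentiableAt_of_smooth (hU : IsOpen U) (hF : ContDiffOn ℝ ∞ F U) (hp : p ∈ U) :
    DifferentiableAt ℝ F p :=
  (hF.contDiffAt (hU.mem_nhds hp)).differentiableAt (by simp)

theorem smooth_pd (hU : IsOpen U) (hF : ContDiffOn ℝ ∞ F U) (a : Fin 4) :
    ContDiffOn ℝ ∞ (pd a F) U :=
  (hF.fderiv_of_isOpen hU (m := ∞) (by simp)).clm_apply contDiffOn_const

theorem pd_congr (hU : IsOpen U) (h : Set.EqOn F G U) (hp : p ∈ U) (a : Fin 4) :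
    pd a F p = pd a G p := by
  have : F =ᶠ[nhds p] G := Filter.eventuallyEq_of_mem (hU.mem_nhds hp) h
  simp only [pd, this.fderiv_eq]

theorem pd_comm (hU : IsOpen U) (hF : ContDiffOn ℝ ∞ F U) (hp : p ∈ U) (a b : Fin 4) :
    pd a (pd b F) p = pd b (pd a F) p := by
  have hc : ContDiffAt ℝ ∞ F p := hF.contDiffAt (hU.mem_nhds hp)
  have hd : DifferentiableAt ℝ (fderiv ℝ F) p :=
    (hc.fderiv_right (m := 1) (by norm_cast)).differentiableAt (by simp)
  have key : ∀ v w : Pt, fderiv ℝ (fun q => fderiv ℝ F q v) p w = fderiv ℝ (fderiv ℝ F) p w v := by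
    intro v w
    rw [fderiv_clm_apply hd (differentiableAt_const v)]
    simp
  have hs : IsSymmSndFDerivAt ℝ F p :=
    hc.isSymmSndFDerivAt (by simpa using WithTop.coe_le_coe.2 (le_top (a := (2 : ℕ∞))))
  unfold pd
  rw [key, key]
  exact hs.eq _ _

@[simp] theorem pd_const (a : Fin 4) (c : E) : pd a (fun _ : Pt => c) p = 0 := by
  simp [pd]

theorem pd_add (a : Fin 4) (hF : DifferentiableAt ℝ F p) (hG : DifferentiableAt ℝ G p) :
    pd a (fun q => F q + G q) p = pd a F p + pd a G p := by
  simp [pd, fderiv_fun_add hF hG]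

theorem pd_sub (a : Fin 4) (hF : DifferentiableAt ℝ F p) (hG : DifferentiableAt ℝ G p) :
    pd a (fun q => F q - G q) p = pd a F p - pd a G p := by
  simp [pd, fderiv_fun_sub hF hG]

theorem pd_mul {A : Type} [NormedCommRing A] [NormedAlgebra ℝ A] {F G : Pt → A} (a : Fin 4)
    (hF : DifferentiableAt ℝ F p) (hG : DifferentiableAt ℝ G p) :
    pd a (fun q => F q * G q) p = pd a F p * G p + F p * pd a G p := by
  simp [pd, fderiv_fun_mul hF hG]
  ring

theorem pd_const_mul {A : Type} [NormedCommRing A] [NormedAlgebra ℝ A] {F : Pt → A} (a : Fin 4)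
    (c : A) (hF : DifferentiableAt ℝ F p) :
    pd a (fun q => c * F q) p = c * pd a F p := by
  rw [pd_mul a (differentiableAt_const c) hF]; simp

theorem pd_clm {E' : Type} [NormedAddCommGroup E'] [NormedSpace ℝ E'] (L : E →L[ℝ] E')
    (a : Fin 4) (hF : DifferentiableAt ℝ F p) : pd a (fun q => L (F q)) p = L (pd a F p) := by
  have := (L.hasFDerivAt.comp p hF.hasFDerivAt).fderiv
  simp only [pd]
  change (fderiv ℝ (L ∘ F) p) _ = _
  rw [this]; simp

theorem pd_eq_of_hasDerivAt {F' : E} (a : Fin 4) (hF : DifferentiableAt ℝ F p)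
    (h : HasDerivAt (fun t : ℝ => F (p + t • Pi.single a 1)) F' 0) : pd a F p = F' := by
  rw [pd, ← hF.lineDeriv_eq_fderiv]
  exact h.deriv

theorem fderiv_eq_sum_pd (p v : Pt) : fderiv ℝ F p v = ∑ a, v a • pd a F p := by
  conv_lhs => rw [pi_eq_sum_univ' v]
  simp only [map_sum, map_smul, pd]

end PartialDerivatives

/-! ### Curvature of the Brinkmann metric -/

section Curvature

variable {f : ℂ → ℝ → ℂ} {U : Set Pt} {p : Pt}

/-- The complex profile as a function on coordinate space. -/
def profileC (f : ℂ → ℝ → ℂ) (p : Pt) : ℂ := f (zeta p) (p 0)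

/-- The profile `H = Re f` as a function on coordinate space. -/
def profile (f : ℂ → ℝ → ℂ) (p : Pt) : ℝ := (profileC f p).re

/-- Components of the covector `du`. -/
def du : Fin 4 → ℝ := ![1, 0, 0, 0]

@[simp] theorem du_zero : du 0 = 1 := rfl
@[simp] theorem du_one : du 1 = 0 := rfl
@[simp] theorem du_two : du 2 = 0 := rfl
@[simp] theorem du_three : du 3 = 0 := rfl

theorem smooth_profileC (hf : IsProfile f U) : ContDiffOn ℝ ∞ (profileC f) U := hf.smooth

theorem smooth_profile (hf : IsProfile f U) : ContDiffOn ℝ ∞ (profile f) U :=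
  Complex.reCLM.contDiff.comp_contDiffOn hf.smooth

theorem pd_re (hU : IsOpen U) {F : Pt → ℂ} (hF : ContDiffOn ℝ ∞ F U) (hp : p ∈ U) (a : Fin 4) :
    pd a (fun q => (F q).re) p = (pd a F p).re :=
  pd_clm Complex.reCLM a (differentiableAt_of_smooth hU hF hp)

theorem pd_one_profileC (hU : IsOpen U) (hf : IsProfile f U) (hp : p ∈ U) :
    pd 1 (profileC f) p = 0 := by
  apply pd_eq_of_hasDerivAt 1 (differentiableAt_of_smooth hU (smooth_profileC hf) hp)
  have : (fun t : ℝ => profileC f (p + t • Pi.single 1 1)) = fun _ => profileC f p := by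
    funext t
    simp [profileC, zeta]
  rw [this]
  exact hasDerivAt_const _ _

/-- Cauchy-Riemann: along either transverse axis the derivative is the complex derivative of `f`
times the direction in which `ζ` moves, `1` or `i`. -/
theorem pd_three_profileC (hU : IsOpen U) (hf : IsProfile f U) (hp : p ∈ U) :
    pd 3 (profileC f) p = Complex.I * pd 2 (profileC f) p := by
  have hd := (hf.holo p hp).hasDerivAt
  have hdiff := differentiableAt_of_smooth hU (smooth_profileC hf) hp
  have key : ∀ c : ℂ, HasDerivAt (fun t : ℝ => f (zeta p + t * c) (p 0))
      (deriv (fun z => f z (p 0)) (zeta p) * c) 0 := by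
    intro c
    have h1 : HasDerivAt (fun t : ℝ => zeta p + t * c) c 0 := by
      simpa using ((Complex.ofRealCLM.hasDerivAt (x := (0 : ℝ))).mul_const c).const_add (zeta p)
    have := HasDerivAt.scomp_of_eq (𝕜 := ℝ) (0 : ℝ) hd h1 (by simp)
    simpa [Function.comp_def, mul_comm] using this
  have h2 : pd 2 (profileC f) p = deriv (fun z => f z (p 0)) (zeta p) * 1 := by
    refine pd_eq_of_hasDerivAt 2 hdiff ((key 1).congr_of_eventuallyEq
      (.of_forall fun t => ?_))
    simp only [profileC]
    congr 1
    · apply Complex.ext <;> simp [zeta]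
    · simp
  have h3 : pd 3 (profileC f) p = deriv (fun z => f z (p 0)) (zeta p) * Complex.I := by
    refine pd_eq_of_hasDerivAt 3 hdiff ((key Complex.I).congr_of_eventuallyEq
      (.of_forall fun t => ?_))
    simp only [profileC]
    congr 1
    · apply Complex.ext <;> simp [zeta]
    · simp
  rw [h2, h3]; ring

theorem pd_one_profile (hU : IsOpen U) (hf : IsProfile f U) (hp : p ∈ U) :
    pd 1 (profile f) p = 0 := by
  refine (pd_re hU (smooth_profileC hf) hp 1).trans ?_
  rw [pd_one_profileC hU hf hp, Complex.zero_re]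

theorem pd_pd_one_profile (hU : IsOpen U) (hf : IsProfile f U) (hp : p ∈ U) (a : Fin 4) :
    pd a (pd 1 (profile f)) p = 0 := by
  rw [pd_congr hU (G := fun _ => 0) (fun q hq => pd_one_profile hU hf hq) hp]
  simp

theorem pd_one_pd_profile (hU : IsOpen U) (hf : IsProfile f U) (hp : p ∈ U) (a : Fin 4) :
    pd 1 (pd a (profile f)) p = 0 := by
  rw [pd_comm hU (smooth_profile hf) hp, pd_pd_one_profile hU hf hp]

/-- The profile is harmonic in the transverse coordinates. -/
theorem profile_harmonic (hU : IsOpen U) (hf : IsProfile f U) (hp : p ∈ U) :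
    pd 3 (pd 3 (profile f)) p = -pd 2 (pd 2 (profile f)) p := by
  have hc := smooth_profileC hf
  have hre : ∀ a, ∀ q ∈ U, pd a (pd a (profile f)) q = (pd a (pd a (profileC f)) q).re := by
    intro a q hq
    exact (pd_congr hU (fun r hr => pd_re hU hc hr a) hq a).trans
      (pd_re hU (smooth_pd hU hc a) hq a)
  rw [hre 3 p hp, hre 2 p hp, ← Complex.neg_re]
  congr 1
  -- The Cauchy-Riemann relation is applied twice, with the mixed partials exchanged in between; the
  -- factor is `i² = -1`.
  have h2 := smooth_pd hU hc 2
  have e : ∀ a, pd a (pd 3 (profileC f)) p = Complex.I * pd a (pd 2 (profileC f)) p := by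
    intro a
    rw [pd_congr hU (fun r hr => pd_three_profileC hU hf hr) hp,
      pd_const_mul _ _ (differentiableAt_of_smooth hU h2 hp)]
  rw [e 3, pd_comm hU hc hp, e 2, ← mul_assoc, Complex.I_mul_I]; ring

theorem brinkmann_inv (f : ℂ → ℝ → ℂ) (p : Pt) : (brinkmann f p)⁻¹ =
    !![0, -1, 0, 0; -1, 2 * profile f p, 0, 0; 0, 0, 1 / 2, 0; 0, 0, 0, 1 / 2] := by
  apply Matrix.inv_eq_right_inv
  ext i j
  fin_cases i <;> fin_cases j <;>
    simp [brinkmann, profile, profileC, Matrix.mul_apply, Fin.sum_univ_four]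

theorem pd_brinkmann (hU : IsOpen U) (hf : IsProfile f U) (hp : p ∈ U) (a b c : Fin 4) :
    pd a (fun q => brinkmann f q b c) p = -2 * pd a (profile f) p * du b * du c := by
  have h := pd_const_mul a (-2 : ℝ) (differentiableAt_of_smooth hU (smooth_profile hf) hp)
  fin_cases b <;> fin_cases c <;> simp [brinkmann]
  simpa [profile, profileC] using h

/-- The gradient `g^{ab} ∂_b H` of the profile. -/
def gradProfile (f : ℂ → ℝ → ℂ) (a : Fin 4) (p : Pt) : ℝ :=
  ![0, -pd 0 (profile f) p, (1 / 2) * pd 2 (profile f) p, (1 / 2) * pd 3 (profile f) p] a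

/-- Components of the vector `∂_v`. -/
def ev : Fin 4 → ℝ := ![0, 1, 0, 0]

@[simp] theorem ev_zero : ev 0 = 0 := rfl
@[simp] theorem ev_one : ev 1 = 1 := rfl
@[simp] theorem ev_two : ev 2 = 0 := rfl
@[simp] theorem ev_three : ev 3 = 0 := rfl

theorem christoffel_brinkmann (hU : IsOpen U) (hf : IsProfile f U) (hp : p ∈ U) (a b c : Fin 4) :
    christoffel (brinkmann f) p a b c =
      ev a * (pd b (profile f) p * du c + pd c (profile f) p * du b)
        + gradProfile f a p * (du b * du c) := by
  simp only [christoffel, pd_brinkmann hU hf hp, brinkmann_inv, Fin.sum_univ_four]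
  have h1 := pd_one_profile hU hf hp
  fin_cases a <;> simp [gradProfile, h1] <;> ring

theorem smooth_gradProfile (hU : IsOpen U) (hf : IsProfile f U) (a : Fin 4) :
    ContDiffOn ℝ ∞ (gradProfile f a) U := by
  have h := fun b => smooth_pd hU (smooth_profile hf) b
  fin_cases a
  · exact contDiffOn_const
  · exact (h 0).neg
  · exact contDiffOn_const.mul (h 2)
  · exact contDiffOn_const.mul (h 3)

theorem pd_christoffel_brinkmann (hU : IsOpen U) (hf : IsProfile f U) (hp : p ∈ U)
    (a b c d : Fin 4) :
    pd d (fun q => christoffel (brinkmann f) q a b c) p =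
      ev a * (pd d (pd b (profile f)) p * du c + pd d (pd c (profile f)) p * du b)
        + pd d (gradProfile f a) p * (du b * du c) := by
  rw [pd_congr hU (fun q hq => christoffel_brinkmann hU hf hq a b c) hp]
  have h := fun b => differentiableAt_of_smooth hU (smooth_pd hU (smooth_profile hf) b) hp
  have hG := differentiableAt_of_smooth hU (smooth_gradProfile hU hf a) hp
  have e1 : ∀ x y, pd d (fun q => pd x (profile f) q * du y) p
      = pd d (pd x (profile f)) p * du y := by
    intro x y
    rw [pd_mul d (h x) (differentiableAt_const _)]; simp
  rw [pd_add, pd_const_mul, pd_add, e1, e1, pd_mul d hG (differentiableAt_const _)]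
  · simp
  all_goals fun_prop (disch := assumption)

theorem pd_gradProfile (hU : IsOpen U) (hf : IsProfile f U) (hp : p ∈ U) (a b : Fin 4) :
    pd b (gradProfile f a) p = ![0, -pd b (pd 0 (profile f)) p,
      (1 / 2) * pd b (pd 2 (profile f)) p, (1 / 2) * pd b (pd 3 (profile f)) p] a := by
  have h := fun b => differentiableAt_of_smooth hU (smooth_pd hU (smooth_profile hf) b) hp
  fin_cases a
  · exact pd_const b 0
  · have := pd_const_mul b (-1 : ℝ) (h 0)
    simp only [neg_one_mul] at this
    exact this
  · exact pd_const_mul b (1 / 2 : ℝ) (h 2)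
  · exact pd_const_mul b (1 / 2 : ℝ) (h 3)

/-- Linear in second derivatives of `H`: the contractions of `∂_v` with `du` and `dH`, and of `grad
H` with `du`, vanish. The one surviving quadratic term, `|grad H|² du_b du_c du_d` along `∂_v`, is
symmetric in `c, d` and drops out. -/
theorem riemann_brinkmann (hU : IsOpen U) (hf : IsProfile f U) (hp : p ∈ U) (a b c d : Fin 4) :
    riemann (brinkmann f) p a b c d =
      ev a * (pd b (pd c (profile f)) p * du d - pd b (pd d (profile f)) p * du c)
        + du b * (pd c (gradProfile f a) p * du d - pd d (gradProfile f a) p * du c) := by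
  have h1 := pd_one_profile hU hf hp
  have hs := pd_comm hU (smooth_profile hf) hp
  simp only [riemann, pd_christoffel_brinkmann hU hf hp, christoffel_brinkmann hU hf hp,
    Fin.sum_univ_four]
  rw [hs d c, hs b c, hs b d]
  simp [gradProfile, h1]
  ring

/-- The trace leaves only a multiple of the transverse Laplacian of `H`. -/
theorem ricci_brinkmann (hU : IsOpen U) (hf : IsProfile f U) (hp : p ∈ U) (b d : Fin 4) :
    ricci (brinkmann f) p b d = 0 := by
  have h1 := pd_one_pd_profile hU hf hp
  have h2 := pd_pd_one_profile hU hf hp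
  have h3 := profile_harmonic hU hf hp
  simp only [ricci, riemann_brinkmann hU hf hp, Fin.sum_univ_four, pd_gradProfile hU hf hp, h3]
  simp [h1, h2]

theorem weyl_brinkmann (hU : IsOpen U) (hf : IsProfile f U) (hp : p ∈ U) (a b c d : Fin 4) :
    weyl (brinkmann f) p a b c d =
      du a * du c * pd b (pd d (profile f)) p + du b * du d * pd a (pd c (profile f)) p
        - du a * du d * pd b (pd c (profile f)) p - du b * du c * pd a (pd d (profile f)) p := by
  have h1 := pd_one_pd_profile hU hf hp
  have hs := pd_comm hU (smooth_profile hf) hp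
  have hw : weyl (brinkmann f) p a b c d = riemannLow (brinkmann f) p a b c d := by
    simp [weyl, ricci_brinkmann hU hf hp, scalarCurv]
  rw [hw, riemannLow]
  simp only [riemann_brinkmann hU hf hp, Fin.sum_univ_four, pd_gradProfile hU hf hp]
  rw [hs a c, hs a d]
  fin_cases a <;> simp [brinkmann, pd_pd_one_profile hU hf hp] <;> ring

/-- Only the bivector components pairing `u` with a transverse direction contribute, and
trace-freeness of the Hessian leaves two independent coefficients. -/
theorem weylC_brinkmann (hU : IsOpen U) (hf : IsProfile f U) (hp : p ∈ U) (X Y V W : CVec) :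
    weylC (brinkmann f) p X Y V W =
      pd 2 (pd 2 (profile f)) p *
          ((X 0 * Y 2 - X 2 * Y 0) * (V 0 * W 2 - V 2 * W 0)
            - (X 0 * Y 3 - X 3 * Y 0) * (V 0 * W 3 - V 3 * W 0))
        + pd 2 (pd 3 (profile f)) p *
          ((X 0 * Y 2 - X 2 * Y 0) * (V 0 * W 3 - V 3 * W 0)
            + (X 0 * Y 3 - X 3 * Y 0) * (V 0 * W 2 - V 2 * W 0)) := by
  have h1 := pd_one_pd_profile hU hf hp
  have h2 := pd_pd_one_profile hU hf hp
  have h3 := profile_harmonic hU hf hp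
  have hs := pd_comm hU (smooth_profile hf) hp
  simp only [weylC, weyl_brinkmann hU hf hp, Fin.sum_univ_four]
  rw [hs 3 2, hs 2 0, hs 3 0, h3]
  simp [h1, h2]
  ring

end Curvature

/-! ### Canonical tetrads of the Brinkmann metric -/

section CanonicalTetrad

open ComplexConjugate

variable {f : ℂ → ℝ → ℂ} {U : Set Pt} {e : Tetrad} {p : Pt}

theorem inn_brinkmann (f : ℂ → ℝ → ℂ) (p : Pt) (X Y : CVec) : inn (brinkmann f) p X Y =
    -2 * profile f p * X 0 * Y 0 - X 0 * Y 1 - X 1 * Y 0 + 2 * X 2 * Y 2 + 2 * X 3 * Y 3 := by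
  simp [inn, brinkmann, Fin.sum_univ_four, profile, profileC]
  ring

theorem eq_zero_of_add_mul_eq_zero {ε : ℂ} (hε : ε = Complex.I ∨ ε = -Complex.I) {x y : ℝ}
    (h : (x : ℂ) + ε * y = 0) : x = 0 ∧ y = 0 := by
  rcases hε with rfl | rfl
  · simpa [Complex.ext_iff] using h
  · simpa [Complex.ext_iff] using h

theorem eq_or_eq_neg_mul_of_sq_add_sq_eq_zero {x y : ℂ} (h : x ^ 2 + y ^ 2 = 0) :
    ∃ ε : ℂ, (ε = Complex.I ∨ ε = -Complex.I) ∧ y = ε * x := by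
  have h' : (y - Complex.I * x) * (y + Complex.I * x) = 0 := by
    linear_combination h - x ^ 2 * Complex.I_sq
  rcases mul_eq_zero.1 h' with h | h
  · exact ⟨_, Or.inl rfl, by linear_combination h⟩
  · exact ⟨_, Or.inr rfl, by linear_combination h⟩

theorem sq_eq_neg_one_of_eq {ε : ℂ} (hε : ε = Complex.I ∨ ε = -Complex.I) : ε ^ 2 = -1 := by
  rcases hε with rfl | rfl <;> simp

theorem conj_eq_neg_of_eq {ε : ℂ} (hε : ε = Complex.I ∨ ε = -Complex.I) : conj ε = -ε := by
  rcases hε with rfl | rfl <;> simp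

theorem neg_eq_of_eq {ε : ℂ} (hε : ε = Complex.I ∨ ε = -Complex.I) :
    -ε = Complex.I ∨ -ε = -Complex.I := by
  rcases hε with rfl | rfl <;> simp

theorem psi4_brinkmann (hU : IsOpen U) (hf : IsProfile f U)
    (he : e.IsCanonical (brinkmann f) U) (hp : p ∈ U) :
    pd 2 (pd 2 (profile f)) p ≠ 0 ∨ pd 2 (pd 3 (profile f)) p ≠ 0 := by
  by_contra! h
  have h4 := he.psi4_eq p hp
  rw [Tetrad.psi4, weylC_brinkmann hU hf hp, h.1, h.2] at h4
  simp at h4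

/-- The first leg of a canonical tetrad is aligned with the wave vector `∂_v`. -/
theorem l_zero (hU : IsOpen U) (hf : IsProfile f U)
    (he : e.IsCanonical (brinkmann f) U) (hp : p ∈ U) : e.l p 0 = 0 := by
  have h0 := he.psi0_eq p hp
  rw [Tetrad.psi0, weylC_brinkmann hU hf hp] at h0
  have hll := he.l_l p hp
  have hlm := he.l_m p hp
  have hmm := he.m_m p hp
  have hmb := he.m_mBar p hp
  rw [inn_brinkmann] at hll hlm hmm hmb
  have hlm' := congrArg conj hlm
  simp only [Tetrad.lC, Tetrad.mBar, cconj, map_sub, map_add, map_mul, map_neg, map_ofNat,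
    Complex.conj_ofReal, map_zero] at h0 hll hlm hmm hmb hlm'
  -- These are the transverse components of `X = ℓ^u m - m^u ℓ`, which has no `u` component.
  -- Computing `g(X, X) = 0` and `g(X, X̄) = (ℓ^u)²` from the tetrad relations gives `hsq` and
  -- `hnorm`.
  set D2 : ℂ := e.l p 0 * e.m p 2 - e.l p 2 * e.m p 0 with hD2
  set D3 : ℂ := e.l p 0 * e.m p 3 - e.l p 3 * e.m p 0 with hD3
  have hsq : D2 ^ 2 + D3 ^ 2 = 0 := by
    rw [hD2, hD3]
    linear_combination (e.l p 0 : ℂ) ^ 2 / 2 * hmm - (e.l p 0 : ℂ) * e.m p 0 * hlm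
      + e.m p 0 ^ 2 / 2 * hll
  have hnorm : 2 * (D2 * conj D2 + D3 * conj D3) = (e.l p 0 : ℂ) ^ 2 := by
    rw [hD2, hD3]
    simp only [map_sub, map_mul, Complex.conj_ofReal]
    linear_combination (e.l p 0 : ℂ) ^ 2 * hmb - (e.l p 0 : ℂ) * conj (e.m p 0) * hlm
      - (e.l p 0 : ℂ) * e.m p 0 * hlm' + e.m p 0 * conj (e.m p 0) * hll
  obtain ⟨ε, hε, h3⟩ := eq_or_eq_neg_mul_of_sq_add_sq_eq_zero hsq
  have hε2 := sq_eq_neg_one_of_eq hε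
  -- Isotropy of `X` reduces `Ψ₀` to `2 D2² (H_xx + ε H_xy)`; the second factor is nonzero because
  -- `Ψ₄ ≠ 0`.
  have hD : D2 ^ 2 *
      (((pd 2 (pd 2 (profile f)) p : ℝ) : ℂ) + ε * ((pd 2 (pd 3 (profile f)) p : ℝ) : ℂ)) = 0 := by
    rw [h3] at h0
    linear_combination h0 / 2 + ((pd 2 (pd 2 (profile f)) p : ℝ) : ℂ) * D2 ^ 2 / 2 * hε2
  have hD20 : D2 = 0 := by
    rcases mul_eq_zero.1 hD with h | h
    · exact pow_eq_zero_iff (two_ne_zero) |>.1 h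
    · obtain ⟨ha, hb⟩ := eq_zero_of_add_mul_eq_zero hε h
      rcases psi4_brinkmann hU hf he hp with h | h <;> contradiction
  rw [h3, hD20] at hnorm
  simpa using hnorm.symm

/-- The components of a canonical tetrad of the Brinkmann metric. -/
theorem tetrad_components (hU : IsOpen U) (hf : IsProfile f U)
    (he : e.IsCanonical (brinkmann f) U) (hp : p ∈ U) :
    e.l p 2 = 0 ∧ e.l p 3 = 0 ∧ e.l p 1 * e.n p 0 = 1 ∧ e.m p 0 = 0 ∧
      e.m p 2 ^ 2 + e.m p 3 ^ 2 = 0 ∧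
      2 * (e.m p 2 * conj (e.m p 2) + e.m p 3 * conj (e.m p 3)) = 1 := by
  have hl0 := l_zero hU hf he hp
  have hll := he.l_l p hp
  have hln := he.l_n p hp
  have hlm := he.l_m p hp
  have hmm := he.m_m p hp
  have hmb := he.m_mBar p hp
  rw [inn_brinkmann] at hll hln hlm hmm hmb
  simp only [Tetrad.lC, Tetrad.nC, Tetrad.mBar, cconj, hl0, Complex.ofReal_zero]
    at hll hln hlm hmm hmb
  have hll' : e.l p 2 ^ 2 + e.l p 3 ^ 2 = 0 := by
    have : ((e.l p 2 ^ 2 + e.l p 3 ^ 2 : ℝ) : ℂ) = 0 := by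
      push_cast
      linear_combination hll / 2
    exact_mod_cast this
  have h2 : e.l p 2 = 0 := by nlinarith [sq_nonneg (e.l p 2), sq_nonneg (e.l p 3)]
  have h3 : e.l p 3 = 0 := by nlinarith [sq_nonneg (e.l p 2), sq_nonneg (e.l p 3)]
  simp only [h2, h3, Complex.ofReal_zero] at hln hlm
  have h1 : e.l p 1 * e.n p 0 = 1 := by
    have : ((e.l p 1 * e.n p 0 : ℝ) : ℂ) = 1 := by
      push_cast
      linear_combination -hln
    exact_mod_cast this
  have hl1 : (e.l p 1 : ℂ) ≠ 0 := by
    have := left_ne_zero_of_mul_eq_one h1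
    exact_mod_cast this
  have hm0 : e.m p 0 = 0 := by
    apply mul_left_cancel₀ hl1
    linear_combination -hlm
  simp only [hm0, map_zero] at hmm hmb
  exact ⟨h2, h3, h1, hm0, by linear_combination hmm / 2, by linear_combination hmb⟩

/-- The derivative of a complex function along a complex tangent vector. -/
def dirD (X : CVec) (F : Pt → ℂ) (p : Pt) : ℂ := ∑ b, X b * pd b F p

theorem dirD_mul (X : CVec) {F G : Pt → ℂ} (hF : DifferentiableAt ℝ F p)
    (hG : DifferentiableAt ℝ G p) :
    dirD X (fun q => F q * G q) p = dirD X F p * G p + F p * dirD X G p := by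
  simp only [dirD, pd_mul _ hF hG, Fin.sum_univ_four]
  ring

theorem smooth_apply {F : Pt → CVec} (hF : ContDiffOn ℝ ∞ F U) (a : Fin 4) :
    ContDiffOn ℝ ∞ (fun q => F q a) U :=
  contDiffOn_pi.1 hF a

theorem smooth_conj {F : Pt → ℂ} (hF : ContDiffOn ℝ ∞ F U) :
    ContDiffOn ℝ ∞ (fun q => conj (F q)) U :=
  Complex.conjCLE.contDiff.comp_contDiffOn hF

theorem smooth_ofReal {F : Pt → ℝ} (hF : ContDiffOn ℝ ∞ F U) :
    ContDiffOn ℝ ∞ (fun q => (F q : ℂ)) U :=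
  Complex.ofRealCLM.contDiff.comp_contDiffOn hF

theorem pd_ofReal {F : Pt → ℝ} (hF : DifferentiableAt ℝ F p) (a : Fin 4) :
    pd a (fun q => (F q : ℂ)) p = ((pd a F p : ℝ) : ℂ) :=
  pd_clm Complex.ofRealCLM a hF

theorem pd_ofReal_add_mul {F G : Pt → ℝ} (hF : DifferentiableAt ℝ F p)
    (hG : DifferentiableAt ℝ G p) (c : ℂ) (a : Fin 4) :
    pd a (fun q => (F q : ℂ) + c * G q) p = ((pd a F p : ℝ) : ℂ) + c * ((pd a G p : ℝ) : ℂ) := by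
  have dF : DifferentiableAt ℝ (fun q => (F q : ℂ)) p :=
    Complex.ofRealCLM.differentiableAt.comp p hF
  have dG : DifferentiableAt ℝ (fun q => (G q : ℂ)) p :=
    Complex.ofRealCLM.differentiableAt.comp p hG
  rw [pd_add a dF (dG.const_mul _), pd_const_mul a _ dG, pd_ofReal hF, pd_ofReal hG]

theorem covD_zero (hU : IsOpen U) (hf : IsProfile f U) (hp : p ∈ U) (X : CVec) (V : Pt → CVec) :
    covD (brinkmann f) p X V 0 = dirD X (fun q => V q 0) p := by
  simp [covD, dirD, christoffel_brinkmann hU hf hp, gradProfile]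

/-- Christoffel symbols with a transverse upper index are multiples of `du_b du_c`, so they do not
act on a field without `u` component at the point. -/
theorem covD_transverse (hU : IsOpen U) (hf : IsProfile f U) (hp : p ∈ U) (X : CVec)
    {V : Pt → CVec} (hV : V p 0 = 0) {a : Fin 4} (ha : a = 2 ∨ a = 3) :
    covD (brinkmann f) p X V a = dirD X (fun q => V q a) p := by
  have : ev a = 0 := by rcases ha with rfl | rfl <;> rfl
  simp [covD, dirD, christoffel_brinkmann hU hf hp, this, Fin.sum_univ_four, hV]

/-- Near each point, the transverse part of `m` has a fixed orientation. -/
theorem exists_orientation (hU : IsOpen U) (hf : IsProfile f U)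
    (he : e.IsCanonical (brinkmann f) U) (hp : p ∈ U) :
    ∃ ε : ℂ, (ε = Complex.I ∨ ε = -Complex.I) ∧ ∃ V ⊆ U, IsOpen V ∧ p ∈ V ∧
      ∀ q ∈ V, e.m q 3 = ε * e.m q 2 := by
  obtain ⟨-, -, -, -, hsq, hn⟩ := tetrad_components hU hf he hp
  obtain ⟨ε, hε, h3⟩ := eq_or_eq_neg_mul_of_sq_add_sq_eq_zero hsq
  have hε2 := sq_eq_neg_one_of_eq hε
  have hm2 : e.m p 2 ≠ 0 := by
    intro h
    rw [h3, h] at hn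
    simp at hn
  have hε0 : ε ≠ 0 := by
    intro h
    simp [h] at hε2
  -- The factor belonging to the opposite orientation is nonzero at `p`, hence nearby, so there the
  -- other factor of `m_x² + m_y² = 0` must vanish.
  have hne : e.m p 3 + ε * e.m p 2 ≠ 0 := by
    rw [h3, ← two_mul]
    exact mul_ne_zero two_ne_zero (mul_ne_zero hε0 hm2)
  have hc : ContinuousOn (fun q => e.m q 3 + ε * e.m q 2) U :=
    (smooth_apply he.smooth_m 3).continuousOn.add
      (continuousOn_const.mul (smooth_apply he.smooth_m 2).continuousOn)
  refine ⟨ε, hε, _, Set.inter_subset_left,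
    hc.isOpen_inter_preimage hU (isOpen_compl_singleton (x := (0 : ℂ))), ⟨hp, hne⟩, ?_⟩
  rintro q ⟨hq, hq'⟩
  obtain ⟨-, -, -, -, hsq, -⟩ := tetrad_components hU hf he hq
  have : (e.m q 3 + ε * e.m q 2) * (e.m q 3 - ε * e.m q 2) = 0 := by
    linear_combination hsq - e.m q 2 ^ 2 * hε2
  rcases mul_eq_zero.1 this with h | h
  · exact absurd h hq'
  · linear_combination h

/-- The two spin coefficients of a canonical tetrad are logarithmic derivatives of the transverse
second derivative of the profile. -/
theorem spin_eq_log_derivative (hU : IsOpen U) (hf : IsProfile f U)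
    (he : e.IsCanonical (brinkmann f) U) {ε : ℂ} (hε : ε = Complex.I ∨ ε = -Complex.I)
    {V : Set Pt} (hVU : V ⊆ U) (hV : IsOpen V) (hm : ∀ q ∈ V, e.m q 3 = ε * e.m q 2)
    (hp : p ∈ V) (X : CVec) :
    4 * ((1 / 2) * (inn (brinkmann f) p (covD (brinkmann f) p X e.nC) (e.lC p)
        - inn (brinkmann f) p (covD (brinkmann f) p X e.mBar) (e.m p)))
        * (pd 2 (pd 2 (profile f)) p + -ε * pd 2 (pd 3 (profile f)) p)
      = dirD X (fun q => ((pd 2 (pd 2 (profile f)) q : ℝ) : ℂ) + -ε * pd 2 (pd 3 (profile f)) q) p := by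
  have hε2 := sq_eq_neg_one_of_eq hε
  have hεc := conj_eq_neg_of_eq hε
  have hpU := hVU hp
  obtain ⟨hl2, hl3, hln, hm0, -, hn⟩ := tetrad_components hU hf he hpU
  have hl0 := l_zero hU hf he hpU
  set A : Pt → ℂ := fun q => (e.n q 0 : ℂ) with hA
  set B : Pt → ℂ := fun q => conj (e.m q 2) with hB
  set Φ : Pt → ℂ := fun q => ((pd 2 (pd 2 (profile f)) q : ℝ) : ℂ) + -ε * pd 2 (pd 3 (profile f)) q
    with hΦ
  have hsm := smooth_profile hf
  have sA : DifferentiableAt ℝ A p :=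
    differentiableAt_of_smooth hU (smooth_ofReal (contDiffOn_pi.1 he.smooth_n 0)) hpU
  have sB : DifferentiableAt ℝ B p :=
    differentiableAt_of_smooth hU (smooth_conj (smooth_apply he.smooth_m 2)) hpU
  have sΦ : DifferentiableAt ℝ Φ p :=
    differentiableAt_of_smooth hU ((smooth_ofReal (smooth_pd hU (smooth_pd hU hsm 2) 2)).add
      (contDiffOn_const.mul (smooth_ofReal (smooth_pd hU (smooth_pd hU hsm 3) 2)))) hpU
  -- This is `Ψ₄ = 1` in components. Its product form is what permits the logarithmic
  -- differentiation in `hD`.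
  have hprod : ∀ q ∈ V, (A q * A q) * ((B q * B q) * Φ q) = 1 / 2 := by
    intro q hq
    have h4 := he.psi4_eq q (hVU hq)
    obtain ⟨-, -, -, hm0, -, -⟩ := tetrad_components hU hf he (hVU hq)
    rw [Tetrad.psi4, weylC_brinkmann hU hf (hVU hq)] at h4
    simp only [Tetrad.nC, Tetrad.mBar, cconj, hm0, hm q hq, map_mul, map_zero, hεc] at h4
    simp only [hA, hB, hΦ]
    linear_combination h4 / 2 +
      (e.n q 0 : ℂ) ^ 2 * conj (e.m q 2) ^ 2 * ((pd 2 (pd 2 (profile f)) q : ℝ) : ℂ) / 2 * hε2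
  have hD : dirD X (fun q => (A q * A q) * ((B q * B q) * Φ q)) p = 0 := by
    simp only [dirD]
    refine Finset.sum_eq_zero fun b _ => ?_
    rw [pd_congr hV (G := fun _ => 1 / 2) hprod hp]
    simp
  rw [dirD_mul X (sA.fun_mul sA) ((sB.fun_mul sB).fun_mul sΦ), dirD_mul X sA sA,
    dirD_mul X (sB.fun_mul sB) sΦ, dirD_mul X sB sB] at hD
  have hmB : 4 * (e.m p 2 * B p) = 1 := by
    rw [hm p hp, map_mul, hεc] at hn
    simp only [hB]
    linear_combination hn + 2 * e.m p 2 * conj (e.m p 2) * hε2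
  have c1 : inn (brinkmann f) p (covD (brinkmann f) p X e.nC) (e.lC p)
      = -(e.l p 1 : ℂ) * dirD X A p := by
    rw [inn_brinkmann, covD_zero hU hf hpU]
    simp only [Tetrad.lC, hl0, hl2, hl3, Complex.ofReal_zero, Tetrad.nC]
    ring
  have hmb0 : ∀ q ∈ V, e.mBar q 0 = 0 := by
    intro q hq
    simp [Tetrad.mBar, cconj, (tetrad_components hU hf he (hVU hq)).2.2.2.1]
  have hmb3 : ∀ q ∈ V, e.mBar q 3 = -ε * B q := by
    intro q hq
    simp [Tetrad.mBar, cconj, hm q hq, hεc, hB]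
  have c2 : inn (brinkmann f) p (covD (brinkmann f) p X e.mBar) (e.m p)
      = 4 * e.m p 2 * dirD X B p := by
    have e0 : dirD X (fun q => e.mBar q 0) p = 0 := by
      simp only [dirD]
      refine Finset.sum_eq_zero fun b _ => ?_
      rw [pd_congr hV (G := fun _ => 0) hmb0 hp]
      simp
    have e3 : dirD X (fun q => e.mBar q 3) p = -ε * dirD X B p := by
      simp only [dirD, Finset.mul_sum]
      refine Finset.sum_congr rfl fun b _ => ?_
      rw [pd_congr hV hmb3 hp, pd_const_mul _ _ sB]
      ring
    have e2 : dirD X (fun q => e.mBar q 2) p = dirD X B p := rfl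
    rw [inn_brinkmann, covD_zero hU hf hpU, covD_transverse hU hf hpU X (hmb0 p hp) (Or.inl rfl),
      covD_transverse hU hf hpU X (hmb0 p hp) (Or.inr rfl), e0, e2, e3, hm p hp, hm0]
    linear_combination -2 * dirD X B p * e.m p 2 * hε2
  have hlA : (e.l p 1 : ℂ) * A p = 1 := by
    simp only [hA]
    exact_mod_cast hln
  have hAn : A p ≠ 0 := right_ne_zero_of_mul_eq_one hlA
  have hBn : B p ≠ 0 := by
    intro h
    rw [h] at hmB
    simp at hmB
  rw [c1, c2]
  change _ * Φ p = dirD X Φ p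
  -- Multiplying by `A²B²` clears the denominators of `dA/A`, `dB/B` and `dΦ/Φ`; `ℓ^v A = 1` and `4
  -- m^x B = 1` supply the inverses.
  apply mul_left_cancel₀ (mul_ne_zero (mul_ne_zero hAn hAn) (mul_ne_zero hBn hBn))
  linear_combination -hD - 2 * A p * B p ^ 2 * Φ p * dirD X A p * hlA
    - 2 * A p ^ 2 * B p * Φ p * dirD X B p * hmB

/-- The third derivatives of the profile of a plane wave. -/
theorem planeWave_third_derivatives (hw : IsVacuumPlaneWave f U e) (hp : p ∈ U) {a : Fin 4}
    (ha : a ≠ 0) :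
    pd a (pd 2 (pd 2 (profile f))) p = 0 ∧ pd a (pd 2 (pd 3 (profile f))) p = 0 := by
  have hU := hw.isOpen
  have hf := hw.profile
  have he := hw.canonical
  have hsm := smooth_profile hf
  have h2 := smooth_pd hU hsm 2
  have h3 := smooth_pd hU hsm 3
  have h22 := differentiableAt_of_smooth hU (smooth_pd hU h2 2) hp
  have h23 := differentiableAt_of_smooth hU (smooth_pd hU h3 2) hp
  obtain ⟨ε, hε, V, hVU, hV, hpV, hm⟩ := exists_orientation hU hf he hp
  have hε2 := sq_eq_neg_one_of_eq hε
  have key := spin_eq_log_derivative hU hf he hε hVU hV hm hpV (e.mBar p)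
  have hα := hw.alpha_eq p hp
  rw [Tetrad.spinAlpha] at hα
  rw [hα] at key
  obtain ⟨-, -, -, hm0, -, hn⟩ := tetrad_components hU hf he hp
  have o2 : pd 1 (pd 2 (pd 2 (profile f))) p = 0 := by
    rw [pd_comm hU h2 hp, pd_congr hU (G := fun _ => 0)
      (fun q hq => pd_one_pd_profile hU hf hq 2) hp]
    simp
  have o3 : pd 1 (pd 2 (pd 3 (profile f))) p = 0 := by
    rw [pd_comm hU h3 hp, pd_congr hU (G := fun _ => 0)
      (fun q hq => pd_one_pd_profile hU hf hq 3) hp]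
    simp
  have s2 : pd 2 (pd 2 (pd 3 (profile f))) p = pd 3 (pd 2 (pd 2 (profile f))) p := by
    rw [pd_congr hU (fun q hq => pd_comm hU hsm hq 2 3) hp, pd_comm hU h2 hp]
  have s3 : pd 3 (pd 2 (pd 3 (profile f))) p = -pd 2 (pd 2 (pd 2 (profile f))) p := by
    rw [pd_comm hU h3 hp, pd_congr hU (fun q hq => profile_harmonic hU hf hq) hp]
    have := pd_const_mul 2 (-1 : ℝ) h22
    simp only [neg_one_mul] at this
    exact this
  have hΦ := fun b => pd_ofReal_add_mul h22 h23 (-ε) b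
  simp only [dirD, Fin.sum_univ_four, hΦ, Tetrad.mBar, cconj, hm p hpV, hm0, o2, o3, s2, s3,
    map_mul, conj_eq_neg_of_eq hε, map_zero, Complex.ofReal_zero, Complex.ofReal_neg] at key
  have hm2 : conj (e.m p 2) ≠ 0 := by
    intro h
    rw [hm p hpV, map_mul, h] at hn
    simp at hn
  -- On `v`-independent functions `m̄` acts as a multiple of `∂_x - ε ∂_y`. Applied to `Φ` it yields
  -- twice this expression by harmonicity, whose real and imaginary parts are third derivatives.
  have hz : ((pd 2 (pd 2 (pd 2 (profile f))) p : ℝ) : ℂ) + -ε * pd 3 (pd 2 (pd 2 (profile f))) p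
      = 0 := by
    apply mul_left_cancel₀ hm2
    linear_combination -key / 2
      + conj (e.m p 2) * ((pd 2 (pd 2 (pd 2 (profile f))) p : ℝ) : ℂ) / 2 * hε2
  obtain ⟨z2, z3⟩ := eq_zero_of_add_mul_eq_zero (neg_eq_of_eq hε) hz
  fin_cases a
  · exact absurd rfl ha
  · exact ⟨o2, o3⟩
  · exact ⟨z2, s2.trans z3⟩
  · exact ⟨z3, s3.trans (by rw [z2, neg_zero])⟩

/-- If `γ` is real, the polarization direction of the plane wave does not depend on `u`. -/
theorem planeWave_constant_polarization (hw : IsVacuumPlaneWave f U e) (hp : p ∈ U)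
    (hγ : (e.spinGamma (brinkmann f) p).im = 0) :
    pd 2 (pd 2 (profile f)) p * pd 0 (pd 2 (pd 3 (profile f))) p
      = pd 2 (pd 3 (profile f)) p * pd 0 (pd 2 (pd 2 (profile f))) p := by
  have hU := hw.isOpen
  have hf := hw.profile
  have he := hw.canonical
  have hsm := smooth_profile hf
  have h22 := differentiableAt_of_smooth hU (smooth_pd hU (smooth_pd hU hsm 2) 2) hp
  have h23 := differentiableAt_of_smooth hU (smooth_pd hU (smooth_pd hU hsm 3) 2) hp
  obtain ⟨ε, hε, V, hVU, hV, hpV, hm⟩ := exists_orientation hU hf he hp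
  have key := spin_eq_log_derivative hU hf he hε hVU hV hm hpV (e.nC p)
  change 4 * (e.spinGamma (brinkmann f) p) * _ = _ at key
  have hreal : e.spinGamma (brinkmann f) p = ((e.spinGamma (brinkmann f) p).re : ℂ) :=
    Complex.ext (by simp) (by simp [hγ])
  rw [hreal] at key
  set g := (e.spinGamma (brinkmann f) p).re
  have hΦ := fun b => pd_ofReal_add_mul h22 h23 (-ε) b
  have z := fun a ha => planeWave_third_derivatives hw hp (a := a) ha
  simp only [dirD, Fin.sum_univ_four, hΦ, Tetrad.nC, z 1 (by decide), z 2 (by decide),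
    z 3 (by decide), Complex.ofReal_zero] at key
  -- `4γΦ = n^u ∂_uΦ` with real `γ` and `n^u` splits into two real equations with the same factors;
  -- eliminating `γ` leaves the Wronskian.
  have hz : ((4 * g * pd 2 (pd 2 (profile f)) p - e.n p 0 * pd 0 (pd 2 (pd 2 (profile f))) p : ℝ)
      : ℂ) + -ε * ((4 * g * pd 2 (pd 3 (profile f)) p
        - e.n p 0 * pd 0 (pd 2 (pd 3 (profile f))) p : ℝ) : ℂ) = 0 := by
    push_cast
    linear_combination key
  obtain ⟨z2, z3⟩ := eq_zero_of_add_mul_eq_zero (neg_eq_of_eq hε) hz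
  have hn : e.n p 0 ≠ 0 := right_ne_zero_of_mul_eq_one (tetrad_components hU hf he hp).2.2.1
  apply mul_left_cancel₀ hn
  linear_combination pd 2 (pd 3 (profile f)) p * z2 - pd 2 (pd 2 (profile f)) p * z3

end CanonicalTetrad

/-! ### The profile of a plane wave with real `γ` -/

section QuadraticProfile

variable {f : ℂ → ℝ → ℂ} {U : Set Pt} {e : Tetrad} {p : Pt}

theorem hasDerivAt_line {F : Pt → ℝ} (x w : Pt) (t : ℝ) (hF : DifferentiableAt ℝ F (x + t • w)) :
    HasDerivAt (fun t : ℝ => F (x + t • w)) (∑ a, w a * pd a F (x + t • w)) t := by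
  have h1 : HasDerivAt (fun t : ℝ => x + t • w) w t := by
    simpa using ((hasDerivAt_id t).smul_const w).const_add x
  have := hF.hasFDerivAt.comp_hasDerivAt t h1
  rw [fderiv_eq_sum_pd] at this
  simpa [Function.comp_def] using this

theorem eq_of_hasDerivAt_zero_Icc {g : ℝ → ℝ} {a b : ℝ}
    (h : ∀ t ∈ Set.Icc a b, HasDerivAt g 0 t) {t : ℝ} (ht : t ∈ Set.Icc a b) : g t = g a :=
  constant_of_has_deriv_right_zero (fun t ht => (h t ht).continuousAt.continuousWithinAt)
    (fun t ht => (h t ⟨ht.1, ht.2.le⟩).hasDerivWithinAt) t ht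

theorem eq_of_hasDerivAt_affine {g : ℝ → ℝ} {α β : ℝ}
    (h : ∀ t ∈ Set.Icc (0 : ℝ) 1, HasDerivAt g (α + β * t) t) {t : ℝ}
    (ht : t ∈ Set.Icc (0 : ℝ) 1) : g t = g 0 + α * t + β * t ^ 2 / 2 := by
  have key : ∀ t ∈ Set.Icc (0 : ℝ) 1,
      HasDerivAt (fun t => g t - (α * t + β * t ^ 2 / 2)) 0 t := by
    intro t ht
    have h2 : HasDerivAt (fun t : ℝ => α * t + β * t ^ 2 / 2) (α + β * t) t := by
      refine (((hasDerivAt_id' t).const_mul α).fun_add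
        ((((hasDerivAt_id' t).fun_pow 2).const_mul β).div_const 2)).congr_deriv ?_
      push_cast
      ring
    exact ((h t ht).fun_sub h2).congr_deriv (sub_self _)
  have := eq_of_hasDerivAt_zero_Icc key ht
  simp at this
  linarith

/-- The point on the `u`-axis through `p` with first coordinate `u`. -/
def axis (p : Pt) (u : ℝ) : Pt := ![u, p 1, p 2, p 3]

theorem axis_mem_ball {δ : ℝ} (hδ : 0 < δ) {u : ℝ} (hu : u ∈ Set.Ioo (p 0 - δ) (p 0 + δ)) :
    axis p u ∈ Metric.ball p δ := by
  rw [Metric.mem_ball, dist_pi_lt_iff hδ]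
  intro i
  fin_cases i
  · simp only [axis, Real.dist_eq, abs_lt]
    exact ⟨by simpa using by linarith [hu.1], by simpa using by linarith [hu.2]⟩
  all_goals simpa [axis] using hδ

theorem coord_zero_mem_of_mem_ball {δ : ℝ} {q : Pt} (hq : q ∈ Metric.ball p δ) :
    q 0 ∈ Set.Ioo (p 0 - δ) (p 0 + δ) := by
  have h := (dist_le_pi_dist q p 0).trans_lt hq
  rw [Real.dist_eq, abs_lt] at h
  constructor <;> linarith [h.1, h.2]

theorem contDiff_axis (p : Pt) : ContDiff ℝ ∞ (axis p) := by
  rw [contDiff_pi]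
  intro i
  fin_cases i
  · exact contDiff_id
  all_goals exact contDiff_const

theorem smooth_comp_axis {δ : ℝ} (hδ : 0 < δ) {F : Pt → ℝ} (hF : ContDiffOn ℝ ∞ F U)
    (hU : Metric.ball p δ ⊆ U) :
    ContDiffOn ℝ ∞ (fun u => F (axis p u)) (Set.Ioo (p 0 - δ) (p 0 + δ)) :=
  hF.comp (contDiff_axis p).contDiffOn fun _ hu => hU (axis_mem_ball hδ hu)

theorem hasDerivAt_comp_axis {F : Pt → ℝ} {u : ℝ} (hF : DifferentiableAt ℝ F (axis p u)) :
    HasDerivAt (fun u => F (axis p u)) (pd 0 F (axis p u)) u := by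
  have h1 : HasDerivAt (axis p) (Pi.single 0 1) u := by
    rw [hasDerivAt_pi]
    intro i
    fin_cases i
    · exact hasDerivAt_id u
    all_goals exact hasDerivAt_const _ _
  exact hF.hasFDerivAt.comp_hasDerivAt u h1

/-- Two functions with vanishing Wronskian and no common zero are proportional. -/
theorem proportional_of_wronskian_eq_zero {a b a' b' : ℝ → ℝ} {l r u₀ : ℝ}
    (ha : ∀ u ∈ Set.Ioo l r, HasDerivAt a (a' u) u) (hb : ∀ u ∈ Set.Ioo l r, HasDerivAt b (b' u) u)
    (hW : ∀ u ∈ Set.Ioo l r, a u * b' u = b u * a' u)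
    (hne : ∀ u ∈ Set.Ioo l r, a u ≠ 0 ∨ b u ≠ 0) (hu₀ : u₀ ∈ Set.Ioo l r) :
    ∀ u ∈ Set.Ioo l r, a u * b u₀ = b u * a u₀ := by
  have hN : ∀ u ∈ Set.Ioo l r, a u ^ 2 + b u ^ 2 ≠ 0 := by
    intro u hu h
    have h1 : a u = 0 := by nlinarith [sq_nonneg (a u), sq_nonneg (b u)]
    have h2 : b u = 0 := by nlinarith [sq_nonneg (a u), sq_nonneg (b u)]
    rcases hne u hu with h | h <;> contradiction
  -- Up to a constant, this quotient is the squared sine of the angle between `(a, b)` at `u` and at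
  -- `u₀`. Unlike `a / b` it is defined even where one of the functions vanishes.
  have hd : ∀ u ∈ Set.Ioo l r, HasDerivAt
      (fun u => (a u * b u₀ - b u * a u₀) ^ 2 / (a u ^ 2 + b u ^ 2)) 0 u := by
    intro u hu
    have h1 := (((ha u hu).mul_const (b u₀)).fun_sub ((hb u hu).mul_const (a u₀))).fun_pow 2
    refine (h1.fun_div (((ha u hu).fun_pow 2).fun_add ((hb u hu).fun_pow 2)) (hN u hu)).congr_deriv ?_
    rw [div_eq_zero_iff]
    left
    have hw := hW u hu
    push_cast
    linear_combination 2 * (a u * b u₀ - b u * a u₀) * (- a u * a u₀ - b u * b u₀) * hw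
  intro u hu
  have hc := isOpen_Ioo.is_const_of_deriv_eq_zero (isPreconnected_Ioo)
    (fun u hu => (hd u hu).differentiableAt.differentiableWithinAt)
    (fun u hu => (hd u hu).deriv) hu hu₀
  simp only [mul_comm (b u₀) (a u₀), sub_self] at hc
  rw [zero_pow two_ne_zero, zero_div, div_eq_zero_iff] at hc
  have := pow_eq_zero_iff two_ne_zero |>.1 (hc.resolve_right (hN u hu))
  linarith

/-- A trace-free symmetric matrix with first row `(x, y)` is diagonalized by the rotation through
half the argument of `x + iy`. -/
theorem exists_half_angle {x y : ℝ} (h : x ≠ 0 ∨ y ≠ 0) :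
    ∃ c s r : ℝ, c ^ 2 + s ^ 2 = 1 ∧ r ≠ 0 ∧ x = r * (c ^ 2 - s ^ 2) ∧ y = r * (2 * s * c) := by
  set z : ℂ := ⟨x, y⟩ with hz
  have hz0 : z ≠ 0 := by
    intro h0
    have := Complex.ext_iff.1 h0
    simp [hz] at this
    rcases h with h | h
    · exact h this.1
    · exact h this.2
  refine ⟨Real.cos (z.arg / 2), Real.sin (z.arg / 2), ‖z‖, Real.cos_sq_add_sin_sq _,
    norm_ne_zero_iff.2 hz0, ?_, ?_⟩
  · rw [← Real.cos_two_mul', mul_div_cancel₀ _ (two_ne_zero), Complex.norm_mul_cos_arg]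
  · rw [← Real.sin_two_mul, mul_div_cancel₀ _ (two_ne_zero), Complex.norm_mul_sin_arg]

/-- On the segment from the axis to `q` the coordinate `u` is fixed, so the transverse Hessian is
constant there. Integrating twice gives first an affine gradient, then a quadratic profile. -/
theorem profile_eq_quadratic (hw : IsVacuumPlaneWave f U e) {δ : ℝ} (hδ : 0 < δ)
    (hball : Metric.ball p δ ⊆ U) {q : Pt} (hq : q ∈ Metric.ball p δ) :
    profile f q = profile f (axis p (q 0))
      + (pd 2 (profile f) (axis p (q 0)) * (q 2 - p 2)
        + pd 3 (profile f) (axis p (q 0)) * (q 3 - p 3))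
      + (pd 2 (pd 2 (profile f)) (axis p (q 0)) * ((q 2 - p 2) ^ 2 - (q 3 - p 3) ^ 2)
        + 2 * pd 2 (pd 3 (profile f)) (axis p (q 0)) * ((q 2 - p 2) * (q 3 - p 3))) / 2 := by
  have hU := hw.isOpen
  have hf := hw.profile
  have hsm := smooth_profile hf
  have hsm2 := fun a => smooth_pd hU hsm a
  set x := axis p (q 0) with hx
  set w : Pt := q - x with hwdef
  have hxb : x ∈ Metric.ball p δ := axis_mem_ball hδ (coord_zero_mem_of_mem_ball hq)
  have hmem : ∀ t ∈ Set.Icc (0 : ℝ) 1, x + t • w ∈ U := fun t ht =>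
    hball ((convex_ball p δ).add_smul_sub_mem hxb hq ht)
  have hw0 : w 0 = 0 := sub_self _
  have hw2 : w 2 = q 2 - p 2 := rfl
  have hw3 : w 3 = q 3 - p 3 := rfl
  have hx0 : x + (0 : ℝ) • w = x := by simp
  have hx1 : x + (1 : ℝ) • w = q := by simp [hwdef]
  have line : ∀ F : Pt → ℝ, ContDiffOn ℝ ∞ F U → ∀ t ∈ Set.Icc (0 : ℝ) 1,
      HasDerivAt (fun t : ℝ => F (x + t • w)) (w 1 * pd 1 F (x + t • w) +
        w 2 * pd 2 F (x + t • w) + w 3 * pd 3 F (x + t • w)) t := by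
    intro F hF t ht
    have := hasDerivAt_line x w t (differentiableAt_of_smooth hU hF (hmem t ht))
    simpa [Fin.sum_univ_four, hw0] using this
  have c22 : ∀ t ∈ Set.Icc (0 : ℝ) 1,
      pd 2 (pd 2 (profile f)) (x + t • w) = pd 2 (pd 2 (profile f)) x := by
    intro t ht
    have := eq_of_hasDerivAt_zero_Icc (fun t ht => by
      have := line _ (smooth_pd hU (hsm2 2) 2) t ht
      have z := fun a ha => (planeWave_third_derivatives hw (hmem t ht) (a := a) ha).1
      simpa only [z 1 (by decide), z 2 (by decide), z 3 (by decide), mul_zero, add_zero]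
        using this) ht
    simpa using this
  have c23 : ∀ t ∈ Set.Icc (0 : ℝ) 1,
      pd 2 (pd 3 (profile f)) (x + t • w) = pd 2 (pd 3 (profile f)) x := by
    intro t ht
    have := eq_of_hasDerivAt_zero_Icc (fun t ht => by
      have := line _ (smooth_pd hU (hsm2 3) 2) t ht
      have z := fun a ha => (planeWave_third_derivatives hw (hmem t ht) (a := a) ha).2
      simpa only [z 1 (by decide), z 2 (by decide), z 3 (by decide), mul_zero, add_zero]
        using this) ht
    simpa using this
  set a := pd 2 (pd 2 (profile f)) x
  set b := pd 2 (pd 3 (profile f)) x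
  have g2 : ∀ t ∈ Set.Icc (0 : ℝ) 1,
      pd 2 (profile f) (x + t • w) = pd 2 (profile f) x + (w 2 * a + w 3 * b) * t := by
    intro t ht
    have := eq_of_hasDerivAt_affine (α := w 2 * a + w 3 * b) (β := 0) (fun t ht => by
      have := line _ (hsm2 2) t ht
      rw [pd_one_pd_profile hU hf (hmem t ht), pd_comm hU hsm (hmem t ht) 3 2, c22 t ht, c23 t ht]
        at this
      exact this.congr_deriv (by ring)) ht
    rw [this, hx0]; ring
  have g3 : ∀ t ∈ Set.Icc (0 : ℝ) 1,
      pd 3 (profile f) (x + t • w) = pd 3 (profile f) x + (w 2 * b - w 3 * a) * t := by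
    intro t ht
    have := eq_of_hasDerivAt_affine (α := w 2 * b - w 3 * a) (β := 0) (fun t ht => by
      have := line _ (hsm2 3) t ht
      rw [pd_one_pd_profile hU hf (hmem t ht), profile_harmonic hU hf (hmem t ht), c22 t ht,
        c23 t ht] at this
      exact this.congr_deriv (by ring)) ht
    rw [this, hx0]; ring
  have g := eq_of_hasDerivAt_affine
    (α := w 2 * pd 2 (profile f) x + w 3 * pd 3 (profile f) x)
    (β := w 2 * (w 2 * a + w 3 * b) + w 3 * (w 2 * b - w 3 * a)) (fun t ht => by
      have := line _ hsm t ht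
      rw [pd_one_profile hU hf (hmem t ht), g2 t ht, g3 t ht] at this
      exact this.congr_deriv (by ring)) (Set.right_mem_Icc.2 zero_le_one)
  rw [hx0, hx1] at g
  rw [g, ← hw2, ← hw3]
  ring

/-- A plane wave with real `γ` is, up to a constant rotation of the transverse plane, linearly
polarized. -/
theorem profile_eq_linearly_polarized (hw : IsVacuumPlaneWave f U e)
    (hγ : ∀ p ∈ U, (e.spinGamma (brinkmann f) p).im = 0) (hp : p ∈ U) :
    ∃ (δ c s : ℝ) (ρ b₁ b₂ h₀ : ℝ → ℝ), 0 < δ ∧ c ^ 2 + s ^ 2 = 1 ∧ Metric.ball p δ ⊆ U ∧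
      ContDiffOn ℝ ∞ ρ (Set.Ioo (p 0 - δ) (p 0 + δ)) ∧
      ContDiffOn ℝ ∞ b₁ (Set.Ioo (p 0 - δ) (p 0 + δ)) ∧
      ContDiffOn ℝ ∞ b₂ (Set.Ioo (p 0 - δ) (p 0 + δ)) ∧
      ContDiffOn ℝ ∞ h₀ (Set.Ioo (p 0 - δ) (p 0 + δ)) ∧
      ∀ q ∈ Metric.ball p δ, profile f q = h₀ (q 0)
        + b₁ (q 0) * (c * (q 2 - p 2) + s * (q 3 - p 3))
        + b₂ (q 0) * (-s * (q 2 - p 2) + c * (q 3 - p 3))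
        + ρ (q 0) / 2 * ((c * (q 2 - p 2) + s * (q 3 - p 3)) ^ 2
          - (-s * (q 2 - p 2) + c * (q 3 - p 3)) ^ 2) := by
  have hU := hw.isOpen
  have hf := hw.profile
  have hsm := smooth_profile hf
  obtain ⟨δ, hδ, hball⟩ := Metric.isOpen_iff.1 hU p hp
  have s2 := smooth_pd hU hsm 2
  have s3 := smooth_pd hU hsm 3
  have s22 := smooth_pd hU s2 2
  have s23 := smooth_pd hU s3 2
  set a : ℝ → ℝ := fun u => pd 2 (pd 2 (profile f)) (axis p u) with ha
  set b : ℝ → ℝ := fun u => pd 2 (pd 3 (profile f)) (axis p u) with hb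
  have hu₀ : p 0 ∈ Set.Ioo (p 0 - δ) (p 0 + δ) := ⟨by linarith, by linarith⟩
  have hmem := fun u hu => hball (axis_mem_ball (p := p) hδ (u := u) hu)
  have hprop := proportional_of_wronskian_eq_zero
    (fun u hu => hasDerivAt_comp_axis (differentiableAt_of_smooth hU s22 (hmem u hu)))
    (fun u hu => hasDerivAt_comp_axis (differentiableAt_of_smooth hU s23 (hmem u hu)))
    (fun u hu => planeWave_constant_polarization hw (hmem u hu) (hγ _ (hmem u hu)))
    (fun u hu => psi4_brinkmann hU hf hw.canonical (hmem u hu)) hu₀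
  obtain ⟨c, s, r, hcs, hr, hac, hbs⟩ :=
    exists_half_angle (psi4_brinkmann hU hf hw.canonical (hmem _ hu₀))
  have sa := smooth_comp_axis hδ s22 hball
  have sb := smooth_comp_axis hδ s23 hball
  have sh2 := smooth_comp_axis hδ s2 hball
  have sh3 := smooth_comp_axis hδ s3 hball
  -- The angle is fixed at `u = p 0`. The first function is the component of `(a, b)` along the
  -- resulting unit vector; proportionality makes it the whole of `(a, b)`.
  refine ⟨δ, c, s, fun u => a u * (c ^ 2 - s ^ 2) + b u * (2 * s * c),
    fun u => c * pd 2 (profile f) (axis p u) + s * pd 3 (profile f) (axis p u),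
    fun u => -s * pd 2 (profile f) (axis p u) + c * pd 3 (profile f) (axis p u),
    fun u => profile f (axis p u), hδ, hcs, hball,
    (sa.mul contDiffOn_const).add (sb.mul contDiffOn_const),
    (contDiffOn_const.mul sh2).add (contDiffOn_const.mul sh3),
    (contDiffOn_const.mul sh2).add (contDiffOn_const.mul sh3),
    smooth_comp_axis hδ hsm hball, ?_⟩
  intro q hq
  have hq0 := coord_zero_mem_of_mem_ball hq
  have hab : a (q 0) * (2 * s * c) = b (q 0) * (c ^ 2 - s ^ 2) := by
    have := hprop (q 0) hq0
    rw [hac, hbs] at this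
    apply mul_left_cancel₀ hr
    linear_combination this
  have hone : (c ^ 2 - s ^ 2) ^ 2 + (2 * s * c) ^ 2 = 1 := by
    linear_combination (c ^ 2 + s ^ 2 + 1) * hcs
  have hA : a (q 0) = (a (q 0) * (c ^ 2 - s ^ 2) + b (q 0) * (2 * s * c)) * (c ^ 2 - s ^ 2) := by
    linear_combination -a (q 0) * hone + (2 * s * c) * hab
  have hB : b (q 0) = (a (q 0) * (c ^ 2 - s ^ 2) + b (q 0) * (2 * s * c)) * (2 * s * c) := by
    linear_combination -b (q 0) * hone - (c ^ 2 - s ^ 2) * hab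
  rw [profile_eq_quadratic hw hδ hball hq]
  change _ + _ + (a (q 0) * _ + 2 * b (q 0) * _) / 2 = _
  beta_reduce
  set R := a (q 0) * (c ^ 2 - s ^ 2) + b (q 0) * (2 * s * c)
  rw [hA, hB]
  linear_combination -(pd 2 (profile f) (axis p (q 0)) * (q 2 - p 2)
        + pd 3 (profile f) (axis p (q 0)) * (q 3 - p 3)) * hcs

end QuadraticProfile

/-! ### Smooth solutions of linear equations and smooth inverses in one variable -/

section OneVariable

theorem hasDerivAt_of_smooth {y : ℝ → ℝ} {s : Set ℝ} (hs : IsOpen s) (hy : ContDiffOn ℝ ∞ y s)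
    {u : ℝ} (hu : u ∈ s) : HasDerivAt y (deriv y u) u :=
  ((hy.contDiffAt (hs.mem_nhds hu)).differentiableAt (by simp)).hasDerivAt

theorem smooth_deriv {y : ℝ → ℝ} {s : Set ℝ} (hs : IsOpen s) (hy : ContDiffOn ℝ ∞ y s) :
    ContDiffOn ℝ ∞ (deriv y) s :=
  hy.deriv_of_isOpen hs (by simp)

/-- Local existence of smooth solutions of `y'' = c y + d`. -/
theorem exists_smooth_solution {c d : ℝ → ℝ} {u₀ δ : ℝ} (hδ : 0 < δ)
    (hc : ContDiffOn ℝ ∞ c (Set.Ioo (u₀ - δ) (u₀ + δ)))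
    (hd : ContDiffOn ℝ ∞ d (Set.Ioo (u₀ - δ) (u₀ + δ))) (y₀ y₁ : ℝ) :
    ∃ η : ℝ, 0 < η ∧ η ≤ δ ∧ ∃ y : ℝ → ℝ, y u₀ = y₀ ∧ deriv y u₀ = y₁ ∧
      ContDiffOn ℝ ∞ y (Set.Ioo (u₀ - η) (u₀ + η)) ∧
      ∀ u ∈ Set.Ioo (u₀ - η) (u₀ + η), HasDerivAt (deriv y) (c u * y u + d u) u := by
  have hu₀ : Set.Ioo (u₀ - δ) (u₀ + δ) ∈ nhds u₀ := Ioo_mem_nhds (by linarith) (by linarith)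
  -- Time is added as a first component to make the system autonomous; `ht` recovers that this
  -- component equals `t`.
  set v : ℝ × ℝ × ℝ → ℝ × ℝ × ℝ := fun x => (1, x.2.2, c x.1 * x.2.1 + d x.1) with hv
  have hcv : ContDiffAt ℝ 1 v (u₀, y₀, y₁) := by
    have c1 : ContDiffAt ℝ 1 (fun x : ℝ × ℝ × ℝ => c x.1) (u₀, y₀, y₁) :=
      ContDiffAt.comp (u₀, y₀, y₁) ((hc.contDiffAt hu₀).of_le (by norm_cast)) contDiffAt_fst
    have d1 : ContDiffAt ℝ 1 (fun x : ℝ × ℝ × ℝ => d x.1) (u₀, y₀, y₁) :=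
      ContDiffAt.comp (u₀, y₀, y₁) ((hd.contDiffAt hu₀).of_le (by norm_cast)) contDiffAt_fst
    refine contDiffAt_const.prodMk (ContDiffAt.prodMk (by fun_prop) ?_)
    exact (c1.mul (by fun_prop)).add d1
  obtain ⟨α, hα0, ε, hε, hα⟩ :=
    hcv.exists_forall_mem_closedBall_exists_eq_forall_mem_Ioo_hasDerivAt₀ u₀
  set η := min ε δ
  have hη : 0 < η := lt_min hε hδ
  set J := Set.Ioo (u₀ - η) (u₀ + η) with hJ
  have hJε : ∀ t ∈ J, t ∈ Set.Ioo (u₀ - ε) (u₀ + ε) := fun t ht =>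
    ⟨by linarith [ht.1, min_le_left ε δ], by linarith [ht.2, min_le_left ε δ]⟩
  have hJδ : J ⊆ Set.Ioo (u₀ - δ) (u₀ + δ) := fun t ht =>
    ⟨by linarith [ht.1, min_le_right ε δ], by linarith [ht.2, min_le_right ε δ]⟩
  have hJ0 : u₀ ∈ J := ⟨by linarith, by linarith⟩
  have h1 : ∀ t ∈ J, HasDerivAt (fun t => (α t).1) 1 t := fun t ht => (hα t (hJε t ht)).fst
  have h2 : ∀ t ∈ J, HasDerivAt (fun t => (α t).2.1) (α t).2.2 t :=
    fun t ht => (hα t (hJε t ht)).snd.fst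
  have h3 : ∀ t ∈ J, HasDerivAt (fun t => (α t).2.2) (c (α t).1 * (α t).2.1 + d (α t).1) t :=
    fun t ht => (hα t (hJε t ht)).snd.snd
  have ht : ∀ t ∈ J, (α t).1 = t := by
    intro t ht
    have hz : ∀ t ∈ J, HasDerivAt (fun t => (α t).1 - t) 0 t := fun t ht =>
      ((h1 t ht).fun_sub (hasDerivAt_id' t)).congr_deriv (sub_self _)
    have := isOpen_Ioo.is_const_of_deriv_eq_zero (isPreconnected_Ioo)
      (fun u hu => (hz u hu).differentiableAt.differentiableWithinAt)
      (fun u hu => (hz u hu).deriv) ht hJ0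
    simp only [hα0, sub_self] at this
    linarith
  set y : ℝ → ℝ := fun t => (α t).2.1 with hy
  set z : ℝ → ℝ := fun t => (α t).2.2 with hz
  have h3' : ∀ t ∈ J, HasDerivAt z (c t * y t + d t) t := by
    intro t htJ
    have := h3 t htJ
    rwa [ht t htJ] at this
  have hdy : ∀ t ∈ J, deriv y t = z t := fun t ht => (h2 t ht).deriv
  -- Bootstrap: `y' = z` and `z' = c y + d` raise the regularity of both functions by one order at a
  -- time.
  have hsm : ∀ n : ℕ, ContDiffOn ℝ n y J ∧ ContDiffOn ℝ n z J := by
    intro n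
    induction n with
    | zero =>
      simp only [Nat.cast_zero, contDiffOn_zero]
      exact ⟨fun t ht => (h2 t ht).continuousAt.continuousWithinAt,
        fun t ht => (h3' t ht).continuousAt.continuousWithinAt⟩
    | succ n ih =>
      push_cast
      rw [contDiffOn_succ_iff_deriv_of_isOpen isOpen_Ioo,
        contDiffOn_succ_iff_deriv_of_isOpen isOpen_Ioo]
      refine ⟨⟨fun t ht => (h2 t ht).differentiableAt.differentiableWithinAt, by simp,
        ih.2.congr hdy⟩, ⟨fun t ht => (h3' t ht).differentiableAt.differentiableWithinAt, by simp,
        ContDiffOn.congr ?_ fun t ht => (h3' t ht).deriv⟩⟩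
      have hc' := (contDiffOn_infty.1 hc n).mono hJδ
      have hd' := (contDiffOn_infty.1 hd n).mono hJδ
      exact (hc'.mul ih.1).add hd'
  refine ⟨η, hη, min_le_right _ _, y, by simp [hy, hα0], by simp [hdy u₀ hJ0, hz, hα0],
    contDiffOn_infty.2 fun n => (hsm n).1, fun u hu => ?_⟩
  exact (h3' u hu).congr_of_eventuallyEq
    (Filter.eventuallyEq_of_mem (isOpen_Ioo.mem_nhds hu) hdy)

/-- A smooth function with positive derivative has a smooth local inverse. -/
theorem exists_smooth_inverse {R : ℝ → ℝ} {u₀ δ : ℝ} (hδ : 0 < δ)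
    (hR : ContDiffOn ℝ ∞ R (Set.Ioo (u₀ - δ) (u₀ + δ)))
    (hpos : 0 < R u₀) (hR' : ∀ u ∈ Set.Ioo (u₀ - δ) (u₀ + δ), 0 < deriv R u) :
    ∃ (a b : ℝ) (τ : ℝ → ℝ) (η : ℝ), 0 < a ∧ 0 < η ∧ η ≤ δ ∧
      ContDiffOn ℝ ∞ τ (Set.Ioo a b) ∧
      (∀ u ∈ Set.Ioo (u₀ - η) (u₀ + η), R u ∈ Set.Ioo a b ∧ τ (R u) = u) ∧
      ∀ w ∈ Set.Ioo a b, τ w ∈ Set.Ioo (u₀ - δ) (u₀ + δ) ∧ R (τ w) = w := by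
  set J := Set.Ioo (u₀ - δ) (u₀ + δ) with hJ
  have hJ0 : u₀ ∈ J := ⟨by linarith, by linarith⟩
  have hat : ∀ u ∈ J, ContDiffAt ℝ ∞ R u := fun u hu => hR.contDiffAt (isOpen_Ioo.mem_nhds hu)
  have hder : ∀ u ∈ J, HasDerivAt R (deriv R u) u := fun u hu =>
    hasDerivAt_of_smooth isOpen_Ioo hR hu
  set Φ := ((hat u₀ hJ0).toOpenPartialHomeomorph R
    ((hder u₀ hJ0).hasFDerivAt_equiv (hR' u₀ hJ0).ne') (by simp)).restrOpen J isOpen_Ioo with hΦ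
  have hsrc : Φ.source ⊆ J := fun u hu => hu.2
  have h0src : u₀ ∈ Φ.source := ⟨(hat u₀ hJ0).mem_toOpenPartialHomeomorph_source _ _, hJ0⟩
  have h0tgt : R u₀ ∈ Φ.target := Φ.map_source h0src
  obtain ⟨ε, hε, hball⟩ := Metric.isOpen_iff.1 Φ.open_target _ h0tgt
  rw [Real.ball_eq_Ioo] at hball
  -- The bound `R u₀ / 2` keeps the interval inside the positive axis.
  set a := max (R u₀ - ε) (R u₀ / 2)
  set b := R u₀ + ε
  have hab : Set.Ioo a b ⊆ Φ.target := fun w hw =>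
    hball ⟨(le_max_left _ _).trans_lt hw.1, hw.2⟩
  have h0ab : R u₀ ∈ Set.Ioo a b := ⟨max_lt (by linarith) (by linarith), by linarith⟩
  have hnhds : Φ.source ∩ R ⁻¹' Set.Ioo a b ∈ nhds u₀ :=
    Filter.inter_mem (Φ.open_source.mem_nhds h0src)
      ((hat u₀ hJ0).continuousAt.preimage_mem_nhds (isOpen_Ioo.mem_nhds h0ab))
  obtain ⟨η, hη, hηball⟩ := Metric.mem_nhds_iff.1 hnhds
  rw [Real.ball_eq_Ioo] at hηball
  refine ⟨a, b, Φ.symm, min η δ, lt_max_of_lt_right (by linarith), lt_min hη hδ, min_le_right _ _,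
    ?_, ?_, ?_⟩
  · intro w hw
    have hm := hsrc (Φ.map_target (hab hw))
    exact (Φ.contDiffAt_symm_deriv (hR' _ hm).ne' (hab hw) (hder _ hm)
      (hat _ hm)).contDiffWithinAt
  · intro u hu
    have := hηball (a := u)
      ⟨by linarith [hu.1, min_le_left η δ], by linarith [hu.2, min_le_left η δ]⟩
    exact ⟨this.2, Φ.left_inv this.1⟩
  · intro w hw
    exact ⟨hsrc (Φ.map_target (hab hw)), Φ.right_inv (hab hw)⟩

/-- Transverse amplitudes of a linearly polarized wave, with increasing area radius `R`. -/
theorem exists_amplitudes {ρ : ℝ → ℝ} {u₀ δ : ℝ} (hδ : 0 < δ)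
    (hρ : ContDiffOn ℝ ∞ ρ (Set.Ioo (u₀ - δ) (u₀ + δ))) :
    ∃ η : ℝ, 0 < η ∧ η ≤ δ ∧ ∃ P Q R : ℝ → ℝ,
      ContDiffOn ℝ ∞ P (Set.Ioo (u₀ - η) (u₀ + η)) ∧
      ContDiffOn ℝ ∞ Q (Set.Ioo (u₀ - η) (u₀ + η)) ∧
      ContDiffOn ℝ ∞ R (Set.Ioo (u₀ - η) (u₀ + η)) ∧
      ∀ u ∈ Set.Ioo (u₀ - η) (u₀ + η), 0 < P u ∧ 0 < Q u ∧ 0 < R u ∧ R u ^ 2 = 2 * P u * Q u ∧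
        0 < deriv R u ∧ R u * deriv R u = deriv P u * Q u + P u * deriv Q u ∧
        HasDerivAt (deriv P) (-(ρ u / 2) * P u) u ∧ HasDerivAt (deriv Q) (ρ u / 2 * Q u) u := by
  -- Value and slope `1` for both `P` and `Q` make `PQ` positive and increasing near `u₀`, so that
  -- `R` can serve as a coordinate.
  obtain ⟨η₁, hη₁, hη₁δ, P, hP0, hP1, hPs, hP2⟩ := exists_smooth_solution hδ
    (hρ.div_const 2).neg (contDiffOn_const (c := (0 : ℝ))) 1 1
  obtain ⟨η₂, hη₂, hη₂δ, Q, hQ0, hQ1, hQs, hQ2⟩ := exists_smooth_solution hδ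
    (hρ.div_const 2) (contDiffOn_const (c := (0 : ℝ))) 1 1
  have hn₁ : Set.Ioo (u₀ - η₁) (u₀ + η₁) ∈ nhds u₀ := Ioo_mem_nhds (by linarith) (by linarith)
  have hn₂ : Set.Ioo (u₀ - η₂) (u₀ + η₂) ∈ nhds u₀ := Ioo_mem_nhds (by linarith) (by linarith)
  have cP : ContinuousAt P u₀ := hPs.continuousOn.continuousAt hn₁
  have cQ : ContinuousAt Q u₀ := hQs.continuousOn.continuousAt hn₂
  have cP' : ContinuousAt (deriv P) u₀ :=
    (smooth_deriv isOpen_Ioo hPs).continuousOn.continuousAt hn₁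
  have cQ' : ContinuousAt (deriv Q) u₀ :=
    (smooth_deriv isOpen_Ioo hQs).continuousOn.continuousAt hn₂
  have hpos : ∀ᶠ u in nhds u₀, 0 < P u ∧ 0 < Q u ∧ 0 < deriv P u ∧ 0 < deriv Q u :=
    (cP.eventually_const_lt (by simp [hP0])).and <| (cQ.eventually_const_lt (by simp [hQ0])).and <|
      (cP'.eventually_const_lt (by simp [hP1])).and (cQ'.eventually_const_lt (by simp [hQ1]))
  obtain ⟨η, hη, hball⟩ := Metric.mem_nhds_iff.1
    (Filter.inter_mem hpos (Filter.inter_mem hn₁ hn₂))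
  rw [Real.ball_eq_Ioo] at hball
  set J := Set.Ioo (u₀ - min η δ) (u₀ + min η δ) with hJ
  have hJ' : J ⊆ Set.Ioo (u₀ - η) (u₀ + η) := fun u hu =>
    ⟨by linarith [hu.1, min_le_left η δ], by linarith [hu.2, min_le_left η δ]⟩
  have hPJ : ContDiffOn ℝ ∞ P J := hPs.mono fun u hu => (hball (hJ' hu)).2.1
  have hQJ : ContDiffOn ℝ ∞ Q J := hQs.mono fun u hu => (hball (hJ' hu)).2.2
  have hprod : ∀ u ∈ J, 0 < 2 * P u * Q u := by
    intro u hu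
    obtain ⟨h1, h2, -, -⟩ := (hball (hJ' hu)).1
    positivity
  have hRJ : ContDiffOn ℝ ∞ (fun u => √(2 * P u * Q u)) J :=
    ((contDiffOn_const.mul hPJ).mul hQJ).sqrt fun u hu => (hprod u hu).ne'
  refine ⟨min η δ, lt_min hη hδ, min_le_right _ _, P, Q, fun u => √(2 * P u * Q u), hPJ, hQJ, hRJ,
    fun u hu => ?_⟩
  obtain ⟨h1, h2, h3, h4⟩ := (hball (hJ' hu)).1
  have hRpos : 0 < √(2 * P u * Q u) := Real.sqrt_pos.2 (hprod u hu)
  have hRR' : √(2 * P u * Q u) * deriv (fun u => √(2 * P u * Q u)) u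
      = deriv P u * Q u + P u * deriv Q u := by
    have hd := (((hasDerivAt_of_smooth isOpen_Ioo hPJ hu).const_mul 2).fun_mul
      (hasDerivAt_of_smooth isOpen_Ioo hQJ hu)).sqrt (hprod u hu).ne'
    rw [hd.deriv]
    field_simp
  have hR' : 0 < deriv (fun u => √(2 * P u * Q u)) u := by
    refine (mul_pos_iff_of_pos_left hRpos).1 ?_
    rw [hRR']
    positivity
  refine ⟨h1, h2, hRpos, Real.sq_sqrt (hprod u hu).le, hR', hRR', ?_, ?_⟩
  · simpa using hP2 u (hball (hJ' hu)).2.1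
  · simpa using hQ2 u (hball (hJ' hu)).2.2

/-- The functions `Y`, `Z` of the Rosen form of a linearly polarized wave. -/
theorem exists_rosen_functions {ρ P Q R : ℝ → ℝ} {u₀ δ : ℝ} (hδ : 0 < δ)
    (hP : ContDiffOn ℝ ∞ P (Set.Ioo (u₀ - δ) (u₀ + δ)))
    (hQ : ContDiffOn ℝ ∞ Q (Set.Ioo (u₀ - δ) (u₀ + δ)))
    (hR : ContDiffOn ℝ ∞ R (Set.Ioo (u₀ - δ) (u₀ + δ)))
    (h : ∀ u ∈ Set.Ioo (u₀ - δ) (u₀ + δ),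
      0 < P u ∧ 0 < Q u ∧ 0 < R u ∧ R u ^ 2 = 2 * P u * Q u ∧
        0 < deriv R u ∧ R u * deriv R u = deriv P u * Q u + P u * deriv Q u ∧
        HasDerivAt (deriv P) (-(ρ u / 2) * P u) u ∧ HasDerivAt (deriv Q) (ρ u / 2 * Q u) u) :
    ∃ (a b η : ℝ) (Y Z : ℝ → ℝ), 0 < a ∧ 0 < η ∧ η ≤ δ ∧
      ContDiffOn ℝ ∞ Y (Set.Ioo a b) ∧ ContDiffOn ℝ ∞ Z (Set.Ioo a b) ∧
      (∀ w ∈ Set.Ioo a b, 2 * deriv Y w = w * deriv Z w ^ 2) ∧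
      ∀ u ∈ Set.Ioo (u₀ - η) (u₀ + η), R u ∈ Set.Ioo a b ∧
        Real.exp (2 * Y (R u)) = 2 / deriv R u ∧ Real.exp (2 * Z (R u)) = P u / Q u := by
  have hJ0 : u₀ ∈ Set.Ioo (u₀ - δ) (u₀ + δ) := ⟨by linarith, by linarith⟩
  obtain ⟨a, b, τ, η, ha, hη, hηδ, hτ, hleft, hright⟩ :=
    exists_smooth_inverse hδ hR (h u₀ hJ0).2.2.1 fun u hu => (h u hu).2.2.2.2.1
  set J := Set.Ioo (u₀ - δ) (u₀ + δ) with hJ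
  have hmaps : Set.MapsTo τ (Set.Ioo a b) J := fun w hw => (hright w hw).1
  have hR' := smooth_deriv isOpen_Ioo hR
  set y : ℝ → ℝ := fun u => Real.log (2 / deriv R u) / 2 with hy
  set z : ℝ → ℝ := fun u => Real.log (P u / Q u) / 2 with hz
  have hys : ContDiffOn ℝ ∞ y J :=
    ((contDiffOn_const.div hR' fun u hu => (h u hu).2.2.2.2.1.ne').log fun u hu =>
      (div_pos two_pos (h u hu).2.2.2.2.1).ne').div_const 2
  have hzs : ContDiffOn ℝ ∞ z J :=
    ((hP.div hQ fun u hu => (h u hu).2.1.ne').log fun u hu =>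
      (div_pos (h u hu).1 (h u hu).2.1).ne').div_const 2
  refine ⟨a, b, η, y ∘ τ, z ∘ τ, ha, hη, hηδ, hys.comp hτ hmaps, hzs.comp hτ hmaps, ?_, ?_⟩
  · intro w hw
    obtain ⟨hu, hw'⟩ := hright w hw
    have hτd := hasDerivAt_of_smooth isOpen_Ioo hτ hw
    set u := τ w with hudef
    obtain ⟨pP, pQ, pR, hRR, pR', hRR', hP2, hQ2⟩ := h u hu
    have dP := hasDerivAt_of_smooth isOpen_Ioo hP hu
    have dQ := hasDerivAt_of_smooth isOpen_Ioo hQ hu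
    have dR := hasDerivAt_of_smooth isOpen_Ioo hR hu
    have dR' := hasDerivAt_of_smooth isOpen_Ioo hR' hu
    have hτ' : deriv R u * deriv τ w = 1 := by
      have h1 := dR.comp w hτd
      have h2 : HasDerivAt (R ∘ τ) 1 w := (hasDerivAt_id w).congr_of_eventuallyEq
        (Filter.eventuallyEq_of_mem (isOpen_Ioo.mem_nhds hw) fun x hx => (hright x hx).2)
      exact h1.unique h2
    -- In the derivative of `R R' = P'Q + PQ'` the terms `P''Q` and `PQ''` cancel: this is where the
    -- vacuum condition enters.
    have hRR'' : deriv R u * deriv R u + R u * deriv (deriv R) u = 2 * deriv P u * deriv Q u := by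
      have h1 := dR.fun_mul dR'
      have h2 := ((hP2.fun_mul dQ).fun_add (dP.fun_mul hQ2)).congr_of_eventuallyEq
        (Filter.eventuallyEq_of_mem (isOpen_Ioo.mem_nhds hu)
          fun x hx => (h x hx).2.2.2.2.2.1)
      rw [h1.unique h2]
      ring
    have dy : HasDerivAt y (-(deriv (deriv R) u / deriv R u) / 2) u := by
      have := ((dR'.fun_inv pR'.ne').const_mul 2).log (by positivity)
      refine (this.div_const 2).congr_deriv ?_
      field_simp
    have dz : HasDerivAt z ((deriv P u / P u - deriv Q u / Q u) / 2) u := by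
      have := (dP.fun_div dQ pQ.ne').log (by positivity)
      refine (this.div_const 2).congr_deriv ?_
      field_simp
    rw [(dy.comp w hτd).deriv, (dz.comp w hτd).deriv]
    have hτe : deriv τ w = 1 / deriv R u := by
      field_simp
      linarith
    rw [hτe, ← hw']
    have e1 : deriv P u * Q u - P u * deriv Q u =
        P u * Q u * (deriv P u / P u - deriv Q u / Q u) := by
      field_simp
    set D := deriv P u / P u - deriv Q u / Q u
    -- Here `D = 2 dz/du`. Combining `hRR''` with `(P'Q + PQ')² - 4PQP'Q' = (P'Q - PQ')²` gives the
    -- vacuum equation in the parameter `u`, before division by `R'²`.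
    have key : -(deriv (deriv R) u) = R u * D ^ 2 / 4 := by
      have hsq : (R u * deriv R u) ^ 2 - 4 * P u * Q u * (deriv P u * deriv Q u)
          = (P u * Q u * D) ^ 2 := by
        rw [← e1, hRR']
        ring
      apply mul_left_cancel₀ (pow_pos pR 3).ne'
      have hPQ : P u * Q u = R u ^ 2 / 2 := by linarith
      rw [hPQ] at hsq
      have hPQ4 : 4 * P u * Q u = 2 * R u ^ 2 := by linarith
      rw [hPQ4] at hsq
      linear_combination hsq - R u ^ 2 * hRR''
    field_simp
    linear_combination 4 * key
  · intro u hu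
    obtain ⟨hm, hτu⟩ := hleft u hu
    have hu' : u ∈ J := ⟨by linarith [hu.1], by linarith [hu.2]⟩
    obtain ⟨pP, pQ, -, -, pR', -, -, -⟩ := h u hu'
    refine ⟨hm, ?_, ?_⟩
    · simp only [Function.comp, hτu, hy]
      rw [mul_div_cancel₀ _ two_ne_zero, Real.exp_log (by positivity)]
    · simp only [Function.comp, hτu, hz]
      rw [mul_div_cancel₀ _ two_ne_zero, Real.exp_log (by positivity)]

end OneVariable

/-! ### The Rosen chart -/

section RosenChart

/-- `F` is differentiable at `q` with partial derivatives `D a`. -/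
def HasGrad (F : Pt → ℝ) (D : Fin 4 → ℝ) (q : Pt) : Prop :=
  DifferentiableAt ℝ F q ∧ ∀ a, pd a F q = D a

namespace HasGrad

variable {F G : Pt → ℝ} {D E : Fin 4 → ℝ} {q : Pt}

theorem add (hF : HasGrad F D q) (hG : HasGrad G E q) :
    HasGrad (fun x => F x + G x) (fun a => D a + E a) q :=
  ⟨hF.1.fun_add hG.1, fun a => by rw [pd_add a hF.1 hG.1, hF.2, hG.2]⟩

theorem sub (hF : HasGrad F D q) (hG : HasGrad G E q) :
    HasGrad (fun x => F x - G x) (fun a => D a - E a) q :=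
  ⟨hF.1.fun_sub hG.1, fun a => by rw [pd_sub a hF.1 hG.1, hF.2, hG.2]⟩

theorem mul (hF : HasGrad F D q) (hG : HasGrad G E q) :
    HasGrad (fun x => F x * G x) (fun a => D a * G q + F q * E a) q :=
  ⟨hF.1.fun_mul hG.1, fun a => by rw [pd_mul a hF.1 hG.1, hF.2, hG.2]⟩

theorem const_mul (c : ℝ) (hF : HasGrad F D q) :
    HasGrad (fun x => c * F x) (fun a => c * D a) q :=
  ⟨hF.1.const_mul c, fun a => by rw [pd_const_mul a c hF.1, hF.2]⟩

theorem coord (i : Fin 4) (c : ℝ) (q : Pt) :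
    HasGrad (fun x => x i - c) (fun a => (Pi.single a 1 : Pt) i) q := by
  have h : HasFDerivAt (fun x : Pt => x i - c)
      (ContinuousLinearMap.proj (R := ℝ) (φ := fun _ : Fin 4 => ℝ) i) q :=
    (ContinuousLinearMap.proj (R := ℝ) (φ := fun _ : Fin 4 => ℝ) i).hasFDerivAt.sub_const c
  exact ⟨h.differentiableAt, fun a => by rw [pd, h.fderiv]; rfl⟩

theorem of_hasDerivAt {y : ℝ → ℝ} {y' : ℝ} (h : HasDerivAt y y' (q 0)) :
    HasGrad (fun x => y (x 0)) (fun a => du a * y') q := by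
  have h0 : HasFDerivAt (fun x : Pt => x 0)
      (ContinuousLinearMap.proj (R := ℝ) (φ := fun _ : Fin 4 => ℝ) 0) q :=
    (ContinuousLinearMap.proj (R := ℝ) (φ := fun _ : Fin 4 => ℝ) 0).hasFDerivAt
  have h1 := h.hasFDerivAt.comp q h0
  refine ⟨h1.differentiableAt, fun a => ?_⟩
  rw [pd]
  change fderiv ℝ (y ∘ fun x : Pt => x 0) q _ = _
  rw [h1.fderiv]
  fin_cases a <;> simp

end HasGrad

/-- A smooth map with injective differential is a local diffeomorphism. -/
theorem exists_smooth_chart {ψ : Pt → Pt} {B : Set Pt} (hB : IsOpen B) (hψ : ContDiffOn ℝ ∞ ψ B)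
    (hinj : ∀ q ∈ B, Function.Injective (fderiv ℝ ψ q)) {p : Pt} (hp : p ∈ B) :
    ∃ φ : OpenPartialHomeomorph Pt Pt, p ∈ φ.source ∧ φ.source ⊆ B ∧ ⇑φ = ψ ∧
      ContDiffOn ℝ ∞ φ.symm φ.target := by
  have hat : ∀ q ∈ B, ContDiffAt ℝ ∞ ψ q := fun q hq => hψ.contDiffAt (hB.mem_nhds hq)
  have hequiv : ∀ q ∈ B, ∃ L : Pt ≃L[ℝ] Pt, HasFDerivAt ψ (L : Pt →L[ℝ] Pt) q := by
    intro q hq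
    have hd := ((hat q hq).differentiableAt (by simp)).hasFDerivAt
    refine ⟨(LinearEquiv.ofInjectiveEndo (fderiv ℝ ψ q : Pt →ₗ[ℝ] Pt)
      (hinj q hq)).toContinuousLinearEquiv, ?_⟩
    exact hd
  obtain ⟨L, hL⟩ := hequiv p hp
  -- Restricting to `B`, where the differential is invertible everywhere, makes the inverse smooth
  -- on the whole target and not only at the image of `p`.
  refine ⟨((hat p hp).toOpenPartialHomeomorph ψ hL (by simp)).restrOpen B hB,
    ⟨(hat p hp).mem_toOpenPartialHomeomorph_source _ _, hp⟩, fun q hq => hq.2, rfl, ?_⟩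
  set Φ := ((hat p hp).toOpenPartialHomeomorph ψ hL (by simp)).restrOpen B hB
  intro w hw
  have hm : Φ.symm w ∈ B := (Φ.map_target hw).2
  obtain ⟨M, hM⟩ := hequiv _ hm
  exact (Φ.contDiffAt_symm hw hM (hat _ hm)).contDiffWithinAt

/-- A map that pulls some tensor field back to the Brinkmann metric is an immersion. -/
theorem fderiv_injective_of_pullback_eq {f : ℂ → ℝ → ℂ} {ψ : Pt → Pt} {h : MetricField} {q : Pt}
    (hψ : DifferentiableAt ℝ ψ q) (hg : brinkmann f q = pullback ψ h q) :
    Function.Injective (fderiv ℝ ψ q) := by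
  rw [injective_iff_map_eq_zero]
  intro v hv
  have hcomp : ∀ c, ∑ a, v a * pd a (fun x => ψ x c) q = 0 := by
    intro c
    have h2 := fderiv_eq_sum_pd (F := fun x => ψ x c) q v
    have h3 : fderiv ℝ (fun x => ψ x c) q v = fderiv ℝ ψ q v c := by
      rw [fderiv_apply hψ c]
      rfl
    rw [h3, hv] at h2
    simpa using h2.symm
  -- A vector killed by the differential lies in the kernel of the pulled-back form, while the
  -- Brinkmann form is nondegenerate.
  have hrow : ∀ b, ∑ a, v a * brinkmann f q a b = 0 := by
    intro b
    simp only [hg, pullback, Matrix.of_apply, Finset.mul_sum]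
    rw [Finset.sum_comm]
    refine Finset.sum_eq_zero fun c _ => ?_
    rw [Finset.sum_comm]
    refine Finset.sum_eq_zero fun d _ => ?_
    have := congrArg (fun t => t * (h (ψ q) c d * pd b (fun x => ψ x d) q)) (hcomp c)
    simp only [zero_mul, Finset.sum_mul] at this
    rw [← this]
    exact Finset.sum_congr rfl fun a _ => by ring
  have r0 := hrow 0
  have r1 := hrow 1
  have r2 := hrow 2
  have r3 := hrow 3
  simp [brinkmann, Fin.sum_univ_four] at r0 r1 r2 r3
  rw [r1] at r0
  ext i
  fin_cases i
  · exact r1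
  · simpa using r0
  · exact r2
  · exact r3

/-- The Rosen form of a linearly polarized wave, pulled back along a map of which the first
component is the area radius `R`. -/
theorem pullback_rosenBPR {ψ : Pt → Pt} {Y Z : ℝ → ℝ} {q : Pt} {P Q R R' : ℝ} {V ξ η : Fin 4 → ℝ}
    (hP : 0 < P) (hQ : 0 < Q) (hR : R ^ 2 = 2 * P * Q) (hR' : 0 < R') (hψ : ψ q 0 = R)
    (hY : Real.exp (2 * Y R) = 2 / R') (hZ : Real.exp (2 * Z R) = P / Q)
    (d0 : ∀ a, pd a (fun x => ψ x 0) q = du a * R') (d1 : ∀ a, pd a (fun x => ψ x 1) q = V a)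
    (d2 : ∀ a, pd a (fun x => ψ x 2) q = P⁻¹ * ξ a)
    (d3 : ∀ a, pd a (fun x => ψ x 3) q = Q⁻¹ * η a) (a b : Fin 4) :
    pullback ψ (rosenBPR Y Z fun _ => 0) q a b
      = -(du a * V b + V a * du b) + 2 * (ξ a * ξ b + η a * η b) := by
  have hZ' : Real.exp (-(2 * Z R)) = Q / P := by
    rw [Real.exp_neg, hZ, inv_div]
  simp only [pullback, Matrix.of_apply, Fin.sum_univ_four, d0, d1, d2, d3, rosenBPR, hψ]
  -- With `W = 0` the transverse coefficients are `R² e^{2Z} = 2P²` and `R² e^{-2Z} = 2Q²`, and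
  -- `e^{2Y} dR = 2 du`.
  simp [hZ, hZ', hR, hY]
  field_simp
  ring

/-- Solutions of the geodesic equation for the origin of the transverse plane, together with the
accompanying shift of `v`. -/
theorem exists_origin {ρ b₁ b₂ h₀ : ℝ → ℝ} {u₀ δ : ℝ} (hδ : 0 < δ)
    (hρ : ContDiffOn ℝ ∞ ρ (Set.Ioo (u₀ - δ) (u₀ + δ)))
    (hb₁ : ContDiffOn ℝ ∞ b₁ (Set.Ioo (u₀ - δ) (u₀ + δ)))
    (hb₂ : ContDiffOn ℝ ∞ b₂ (Set.Ioo (u₀ - δ) (u₀ + δ)))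
    (hh₀ : ContDiffOn ℝ ∞ h₀ (Set.Ioo (u₀ - δ) (u₀ + δ))) :
    ∃ η : ℝ, 0 < η ∧ η ≤ δ ∧ ∃ x y k : ℝ → ℝ,
      ContDiffOn ℝ ∞ x (Set.Ioo (u₀ - η) (u₀ + η)) ∧
      ContDiffOn ℝ ∞ y (Set.Ioo (u₀ - η) (u₀ + η)) ∧
      ContDiffOn ℝ ∞ k (Set.Ioo (u₀ - η) (u₀ + η)) ∧
      ∀ u ∈ Set.Ioo (u₀ - η) (u₀ + η),
        HasDerivAt (deriv x) (-(ρ u / 2) * x u + -(b₁ u / 2)) u ∧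
        HasDerivAt (deriv y) (ρ u / 2 * y u + -(b₂ u / 2)) u ∧
        HasDerivAt k (deriv x u ^ 2 + deriv y u ^ 2 - h₀ u - b₁ u * x u - b₂ u * y u
          - ρ u / 2 * (x u ^ 2 - y u ^ 2)) u := by
  have mono : ∀ {η η' : ℝ}, η' ≤ η → Set.Ioo (u₀ - η') (u₀ + η') ⊆ Set.Ioo (u₀ - η) (u₀ + η) :=
    fun h => Set.Ioo_subset_Ioo (by linarith) (by linarith)
  obtain ⟨η₁, hη₁, hη₁δ, x, -, -, hx, hx2⟩ :=
    exists_smooth_solution hδ (hρ.div_const 2).neg (hb₁.div_const 2).neg 0 0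
  obtain ⟨η₂, hη₂, hη₂₁, y, -, -, hy, hy2⟩ :=
    exists_smooth_solution hη₁ ((hρ.div_const 2).mono (mono hη₁δ))
      ((hb₂.div_const 2).neg.mono (mono hη₁δ)) 0 0
  have m1 : Set.Ioo (u₀ - η₂) (u₀ + η₂) ⊆ Set.Ioo (u₀ - η₁) (u₀ + η₁) := mono hη₂₁
  have mδ : Set.Ioo (u₀ - η₂) (u₀ + η₂) ⊆ Set.Ioo (u₀ - δ) (u₀ + δ) := mono (hη₂₁.trans hη₁δ)
  have hx' := hx.mono m1
  have hdx := smooth_deriv isOpen_Ioo hx'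
  have hdy := smooth_deriv isOpen_Ioo hy
  have hk' : ContDiffOn ℝ ∞ (fun u => deriv x u ^ 2 + deriv y u ^ 2 - h₀ u - b₁ u * x u - b₂ u * y u
      - ρ u / 2 * (x u ^ 2 - y u ^ 2)) (Set.Ioo (u₀ - η₂) (u₀ + η₂)) :=
    (((((hdx.pow 2).add (hdy.pow 2)).sub (hh₀.mono mδ)).sub ((hb₁.mono mδ).mul hx')).sub
      ((hb₂.mono mδ).mul hy)).sub (((hρ.div_const 2).mono mδ).mul ((hx'.pow 2).sub (hy.pow 2)))
  -- The antiderivative `k` is obtained as the derivative of a solution of `K'' = k'`.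
  obtain ⟨η, hη, hη₂', K, -, -, hK, hK2⟩ :=
    exists_smooth_solution hη₂ (contDiffOn_const (c := (0 : ℝ))) hk' 0 0
  refine ⟨η, hη, hη₂'.trans (hη₂₁.trans hη₁δ), x, y, deriv K, hx'.mono (mono hη₂'),
    hy.mono (mono hη₂'), smooth_deriv isOpen_Ioo hK, fun u hu => ⟨hx2 u (m1 (mono hη₂' hu)),
      hy2 u (mono hη₂' hu), ?_⟩⟩
  simpa using hK2 u hu

/-- Since `P d(S/P) = dS - (P'/P) S du`, passing to `S/P` and `T/Q` creates cross terms with `du`,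
which the gradient of `ν` cancels. The remaining `du²` terms reproduce `H` through the Riccati
equations for `P'/P` and `Q'/Q`, the geodesic equations for `x, y` and the choice of `k`. -/
theorem exists_rosenChart {f : ℂ → ℝ → ℂ} {p : Pt} {δ c s : ℝ} {ρ b₁ b₂ h₀ : ℝ → ℝ} (hδ : 0 < δ)
    (hcs : c ^ 2 + s ^ 2 = 1)
    (hρ : ContDiffOn ℝ ∞ ρ (Set.Ioo (p 0 - δ) (p 0 + δ)))
    (hb₁ : ContDiffOn ℝ ∞ b₁ (Set.Ioo (p 0 - δ) (p 0 + δ)))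
    (hb₂ : ContDiffOn ℝ ∞ b₂ (Set.Ioo (p 0 - δ) (p 0 + δ)))
    (hh₀ : ContDiffOn ℝ ∞ h₀ (Set.Ioo (p 0 - δ) (p 0 + δ)))
    (hH : ∀ q ∈ Metric.ball p δ, profile f q = h₀ (q 0)
        + b₁ (q 0) * (c * (q 2 - p 2) + s * (q 3 - p 3))
        + b₂ (q 0) * (-s * (q 2 - p 2) + c * (q 3 - p 3))
        + ρ (q 0) / 2 * ((c * (q 2 - p 2) + s * (q 3 - p 3)) ^ 2
          - (-s * (q 2 - p 2) + c * (q 3 - p 3)) ^ 2)) :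
    ∃ (φ : OpenPartialHomeomorph Pt Pt) (a b : ℝ) (Y Z : ℝ → ℝ),
      p ∈ φ.source ∧ φ.source ⊆ Metric.ball p δ ∧
      IsRosenChart (brinkmann f) φ a b Y Z fun _ => 0 := by
  have mono : ∀ {η η' : ℝ}, η' ≤ η →
      Set.Ioo (p 0 - η') (p 0 + η') ⊆ Set.Ioo (p 0 - η) (p 0 + η) :=
    fun h => Set.Ioo_subset_Ioo (by linarith) (by linarith)
  obtain ⟨η₁, hη₁, hη₁δ, P, Q, R, hP, hQ, hR, hamp⟩ := exists_amplitudes hδ hρ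
  obtain ⟨η₂, hη₂, hη₂δ, x, y, k, hx, hy, hk, hxyk⟩ := exists_origin hδ hρ hb₁ hb₂ hh₀
  obtain ⟨a, b, η₃, Y, Z, ha, hη₃, hη₃₁, hY, hZ, hvac, hYZ⟩ :=
    exists_rosen_functions hη₁ hP hQ hR hamp
  set η := min η₂ η₃ with hηdef
  have hη : 0 < η := lt_min hη₂ hη₃
  have m₂ : η ≤ η₂ := min_le_left _ _
  have m₃ : η ≤ η₃ := min_le_right _ _
  have m₁ : η ≤ η₁ := m₃.trans hη₃₁
  have mδ : η ≤ δ := m₂.trans hη₂δ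
  set B := Metric.ball p η with hB
  set J := Set.Ioo (p 0 - η) (p 0 + η) with hJ
  have hBJ : Set.MapsTo (fun q : Pt => q 0) B J := fun q hq => coord_zero_mem_of_mem_ball hq
  have hPJ := hP.mono (mono m₁)
  have hQJ := hQ.mono (mono m₁)
  have hRJ := hR.mono (mono m₁)
  have hxJ := hx.mono (mono m₂)
  have hyJ := hy.mono (mono m₂)
  have hkJ := hk.mono (mono m₂)
  set S : Pt → ℝ := fun q => c * (q 2 - p 2) + s * (q 3 - p 3) - x (q 0) with hS
  set T : Pt → ℝ := fun q => -s * (q 2 - p 2) + c * (q 3 - p 3) - y (q 0) with hT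
  set ν : Pt → ℝ := fun q => deriv P (q 0) / P (q 0) * (S q * S q) + 2 * (deriv x (q 0) * S q)
    + deriv Q (q 0) / Q (q 0) * (T q * T q) + 2 * (deriv y (q 0) * T q) + k (q 0) with hν
  -- The subtracted `0` matches the shape of `HasGrad.coord`.
  set ψ : Pt → Pt := fun q =>
    ![R (q 0), (q 1 - 0) - ν q, (P (q 0))⁻¹ * S q, (Q (q 0))⁻¹ * T q] with hψ
  have hpos := fun u (hu : u ∈ J) => hamp u (mono m₁ hu)
  have sc : ∀ {y : ℝ → ℝ}, ContDiffOn ℝ ∞ y J → ContDiffOn ℝ ∞ (fun q : Pt => y (q 0)) B :=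
    fun h => h.comp (contDiff_apply ℝ ℝ (0 : Fin 4)).contDiffOn hBJ
  have sS : ContDiffOn ℝ ∞ S B :=
    ContDiffOn.sub (ContDiff.contDiffOn (by fun_prop)) (sc hxJ)
  have sT : ContDiffOn ℝ ∞ T B :=
    ContDiffOn.sub (ContDiff.contDiffOn (by fun_prop)) (sc hyJ)
  have sA := (smooth_deriv isOpen_Ioo hPJ).div hPJ fun u hu => (hpos u hu).1.ne'
  have sC := (smooth_deriv isOpen_Ioo hQJ).div hQJ fun u hu => (hpos u hu).2.1.ne'
  have sν : ContDiffOn ℝ ∞ ν B :=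
    (((((sc sA).mul (sS.mul sS)).add
      (contDiffOn_const.mul ((sc (smooth_deriv isOpen_Ioo hxJ)).mul sS))).add
      ((sc sC).mul (sT.mul sT))).add
      (contDiffOn_const.mul ((sc (smooth_deriv isOpen_Ioo hyJ)).mul sT))).add (sc hkJ)
  have sψ : ContDiffOn ℝ ∞ ψ B := by
    rw [contDiffOn_pi]
    intro i
    fin_cases i
    · exact sc hRJ
    · exact ContDiffOn.sub (ContDiff.contDiffOn (by fun_prop)) sν
    · exact (sc (hPJ.inv fun u hu => (hpos u hu).1.ne')).mul sS
    · exact (sc (hQJ.inv fun u hu => (hpos u hu).2.1.ne')).mul sT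
  have hmetric : ∀ q ∈ B, brinkmann f q = pullback ψ (rosenBPR Y Z fun _ => 0) q := by
    intro q hq
    have hu : q 0 ∈ J := hBJ hq
    obtain ⟨pP, pQ, -, hRR, pR', -, hP2, hQ2⟩ := hpos _ hu
    obtain ⟨hx2, hy2, hk1⟩ := hxyk _ (mono m₂ hu)
    obtain ⟨-, hYu, hZu⟩ := hYZ _ (mono m₃ hu)
    have dP := hasDerivAt_of_smooth isOpen_Ioo hPJ hu
    have dQ := hasDerivAt_of_smooth isOpen_Ioo hQJ hu
    have dx := hasDerivAt_of_smooth isOpen_Ioo hxJ hu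
    have dy := hasDerivAt_of_smooth isOpen_Ioo hyJ hu
    have gR := HasGrad.of_hasDerivAt (hasDerivAt_of_smooth isOpen_Ioo hRJ hu)
    have gS : HasGrad S _ q := (((HasGrad.coord 2 (p 2) q).const_mul c).add
      ((HasGrad.coord 3 (p 3) q).const_mul s)).sub (HasGrad.of_hasDerivAt dx)
    have gT : HasGrad T _ q := (((HasGrad.coord 2 (p 2) q).const_mul (-s)).add
      ((HasGrad.coord 3 (p 3) q).const_mul c)).sub (HasGrad.of_hasDerivAt dy)
    have dA : HasDerivAt (fun u => deriv P u / P u)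
        (-(ρ (q 0) / 2) - (deriv P (q 0) / P (q 0)) ^ 2) (q 0) :=
      (hP2.fun_div dP pP.ne').congr_deriv (by field_simp)
    have dC : HasDerivAt (fun u => deriv Q u / Q u)
        (ρ (q 0) / 2 - (deriv Q (q 0) / Q (q 0)) ^ 2) (q 0) :=
      (hQ2.fun_div dQ pQ.ne').congr_deriv (by field_simp)
    have dPi : HasDerivAt (fun u => (P u)⁻¹) (-(P (q 0))⁻¹ * (deriv P (q 0) / P (q 0))) (q 0) :=
      (dP.fun_inv pP.ne').congr_deriv (by field_simp)
    have dQi : HasDerivAt (fun u => (Q u)⁻¹) (-(Q (q 0))⁻¹ * (deriv Q (q 0) / Q (q 0))) (q 0) :=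
      (dQ.fun_inv pQ.ne').congr_deriv (by field_simp)
    have gν : HasGrad ν _ q := ((((HasGrad.of_hasDerivAt dA).mul (gS.mul gS)).add
      (((HasGrad.of_hasDerivAt hx2).mul gS).const_mul 2)).add
      ((HasGrad.of_hasDerivAt dC).mul (gT.mul gT))).add
      (((HasGrad.of_hasDerivAt hy2).mul gT).const_mul 2) |>.add (HasGrad.of_hasDerivAt hk1)
    have gV := (HasGrad.coord 1 0 q).sub gν
    have gX := (HasGrad.of_hasDerivAt dPi).mul gS
    have gY := (HasGrad.of_hasDerivAt dQi).mul gT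
    have hHq := hH q (Metric.ball_subset_ball mδ hq)
    have e1 : c * (q 2 - p 2) + s * (q 3 - p 3) = S q + x (q 0) := by simp only [hS]; ring
    have e2 : -s * (q 2 - p 2) + c * (q 3 - p 3) = T q + y (q 0) := by simp only [hT]; ring
    rw [e1, e2] at hHq
    ext i j
    rw [pullback_rosenBPR (ψ := ψ) pP pQ hRR pR' rfl hYu hZu gR.2 gV.2
      (ξ := fun a => c * (Pi.single a 1 : Pt) 2 + s * (Pi.single a 1 : Pt) 3
        - du a * (deriv x (q 0) + deriv P (q 0) / P (q 0) * S q))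
      (η := fun a => -s * (Pi.single a 1 : Pt) 2 + c * (Pi.single a 1 : Pt) 3
        - du a * (deriv y (q 0) + deriv Q (q 0) / Q (q 0) * T q))
      (fun a => (gX.2 a).trans (by ring)) (fun a => (gY.2 a).trans (by ring))]
    -- All differential equations have been substituted, so each component is a polynomial identity.
    -- Only the `du²` component involves the profile; the transverse ones use `c² + s² = 1`.
    generalize deriv P (q 0) / P (q 0) = A
    generalize deriv Q (q 0) / Q (q 0) = C
    generalize S q = σ at *
    generalize T q = τ at *
    fin_cases i <;> fin_cases j <;> simp [brinkmann]
    · simp only [profile, profileC] at hHq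
      linear_combination -2 * hHq
    all_goals first | ring1 | linear_combination hcs
  -- The metric identity itself shows that `ψ` is an immersion, so no Jacobian is computed.
  obtain ⟨φ, hpφ, hφB, hφψ, hsymm⟩ := exists_smooth_chart Metric.isOpen_ball sψ
    (fun q hq => fderiv_injective_of_pullback_eq
      (differentiableAt_pi.2 fun i => differentiableAt_of_smooth Metric.isOpen_ball
        (contDiffOn_pi.1 sψ i) hq) (hmetric q hq)) (Metric.mem_ball_self (x := p) hη)
  refine ⟨φ, a, b, Y, Z, hpφ, hφB.trans (Metric.ball_subset_ball mδ), ?_⟩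
  exact
    { smooth := by rw [hφψ]; exact sψ.mono hφB
      smooth_symm := hsymm
      pos := ha
      mem := fun q hq => by rw [hφψ]; exact (hYZ _ (mono m₃ (hBJ (hφB hq)))).1
      smooth_Y := hY
      smooth_Z := hZ
      smooth_W := contDiffOn_const
      vacuum := fun u hu => by rw [hvac u hu]; simp
      metric_eq := fun q hq => by rw [hφψ]; exact hmetric q (hφB hq) }

end RosenChart

end PlaneWave

end

theorem corollary2 (U : Set PlaneWave.Pt) (f : ℂ → ℝ → ℂ) (e : PlaneWave.Tetrad)
    (hwave : PlaneWave.IsVacuumPlaneWave f U e)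
    (hgamma : ∀ p ∈ U, (e.spinGamma (PlaneWave.brinkmann f) p).im = 0) :
    ∀ p ∈ U, ∃ (φ : OpenPartialHomeomorph PlaneWave.Pt PlaneWave.Pt) (a b : ℝ) (Y Z W : ℝ → ℝ),
      p ∈ φ.source ∧ φ.source ⊆ U ∧
      PlaneWave.IsRosenChart (PlaneWave.brinkmann f) φ a b Y Z W ∧
      ∀ u ∈ Set.Ioo a b, deriv W u = 0 := by
  intro p hp
  obtain ⟨δ, c, s, ρ, b₁, b₂, h₀, hδ, hcs, hball, hρ, hb₁, hb₂, hh₀, hH⟩ :=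
    PlaneWave.profile_eq_linearly_polarized hwave hgamma hp
  obtain ⟨φ, a, b, Y, Z, hpφ, hφ, hchart⟩ :=
    PlaneWave.exists_rosenChart hδ hcs hρ hb₁ hb₂ hh₀ hH
  exact ⟨φ, a, b, Y, Z, fun _ => 0, hpφ, hφ.trans hball, hchart, fun u _ => deriv_const u 0⟩
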